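/- Complex analytic manifolds are Hausdorff and finite-dimensional; let $\mathcal{A}n$ be the category of complex analytic manifolds and holomorphic maps. Let $G$ be a complex Lie group acting holomorphically on the right on a complex analytic manifold $X$. A (holomorphic) principal $G$-bundle is a holomorphic map $P\to S$ of complex analytic manifolds with a holomorphic right action of $G$ on $P$ for which $P \to S$ is invariant and, locally on $S$, equivariantly biholomorphic over $S$ to $U\times G\to U$. The quotient stack $[X/G]$ is the stack on $\mathcal{A}n$ whose groupoid of $S$-points consists of the pairs $(P,u)$ of a principal $G$-bundle $P\to S$ and a $G$-equivariant holomorphic map $u:P\to X$, with the isomorphisms of principal bundles over $S$ that commute with the maps to $X$. A fine moduli space for a stack $\mathcal{X}$ on $\mathcal{A}n$ is a complex analytic manifold $M$ such that $\mathcal{X}$ is equivalent, over $\mathcal{A}n$, to the stack $\underline{M}: S\mapsto \mathrm{Mor}(S,M)$. **Proposition.** The quotient stack $[X/G]$ admits a fine moduli space if and only if $G$ acts freely and properly on $X$ (properly means that the map $X\times G\to X\times X$, $(x,g)\mapsto(x,x\cdot g)$, is proper). In that case, the orbit space $X/G$, with the quotient topology, admits a structure of complex analytic manifold for which the canonical projection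 $p:X\to X/G$ is a holomorphic principal $G$-bundle and $X/G$ is a fine moduli space for $[X/G]$; more precisely, there is an equivalence $\underline{X/G}\simeq[X/G]$ that sends $\mathrm{id}_{X/G}$ to an object isomorphic, over $X/G$, to the principal $G$-bundle $p:X\to X/G$ equipped with the equivariant map $\mathrm{id}_X:X\to X$. -/

import Mathlib

open CategoryTheory
open scoped Manifold ContDiff RightActions

universe u

/-- A complex analytic manifold: a Hausdorff topological space with a holomorphic atlas modelled on
a finite-dimensional complex normed space. -/
structure AnMfd : Type (u + 1) where
  /-- The underlying set. -/
  carrier : Type u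
  /-- The finite-dimensional complex vector space on which the manifold is modelled. -/
  Model : Type
  [normedAddCommGroup : NormedAddCommGroup Model]
  [normedSpace : NormedSpace ℂ Model]
  [finiteDimensional : FiniteDimensional ℂ Model]
  [topologicalSpace : TopologicalSpace carrier]
  [t2Space : T2Space carrier]
  [chartedSpace : ChartedSpace Model carrier]
  [isManifold : IsManifold 𝓘(ℂ, Model) ω carrier]

namespace AnMfd

instance : CoeSort AnMfd.{u} (Type u) := ⟨AnMfd.carrier⟩

attribute [instance] normedAddCommGroup normedSpace finiteDimensional topologicalSpace t2Space
  chartedSpace isManifold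

/-- The model with corners (without boundary) of a complex analytic manifold. -/
noncomputable abbrev I (M : AnMfd.{u}) : ModelWithCorners ℂ M.Model M.Model := 𝓘(ℂ, M.Model)

/-- The complex analytic manifold attached to unbundled data. -/
abbrev of (E : Type) [NormedAddCommGroup E] [NormedSpace ℂ E] [FiniteDimensional ℂ E]
    (M : Type u) [TopologicalSpace M] [T2Space M] [ChartedSpace E M]
    [IsManifold 𝓘(ℂ, E) ω M] : AnMfd.{u} := ⟨M, E⟩

/-- The category of complex analytic manifolds and holomorphic maps. -/
noncomputable instance : Category.{u} AnMfd.{u} where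
  Hom M N := C^ω⟮M.I, M; N.I, N⟯
  id _ := ContMDiffMap.id
  comp f g := g.comp f

noncomputable instance {M N : AnMfd.{u}} : CoeFun (M ⟶ N) (fun _ => M → N) :=
  ⟨fun f => (show C^ω⟮M.I, M; N.I, N⟯ from f)⟩

/-- The stack represented by a manifold `M`, as a category over `AnMfd`: its objects over `S` are
the holomorphic maps `S ⟶ M`, and the only morphisms over `𝟙 S` are identities. -/
noncomputable abbrev stack (M : AnMfd.{u}) : BasedCategory.{u, u + 1} AnMfd.{u} :=
  BasedCategory.ofFunctor (Over.forget M)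

end AnMfd

/-- `M` is a fine moduli space for the stack `𝒳` (given as a category over the category of complex
analytic manifolds) if `𝒳` is equivalent to the stack represented by `M`. The equivalence is one of
categories over `AnMfd`: both functors commute with the projections to `AnMfd`, and the unit and
counit are natural isomorphisms over identities. -/
def IsFineModuliSpace (𝒳 : BasedCategory.{u, u + 1} AnMfd.{u}) (M : AnMfd.{u}) : Prop :=
  Nonempty (Bicategory.Equivalence 𝒳 M.stack)

section Actions

variable (X G : AnMfd.{u}) [Group G] [MulAction Gᵐᵒᵖ X]

/-- The right action `(x, g) ↦ x · g` of `G` on `X` is holomorphic. -/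
def IsHolomorphicAction : Prop :=
  ContMDiff (X.I.prod G.I) X.I ω (fun q : X × G => q.1 <• q.2)

/-- The right action of `G` on `X` is free: all stabilisers are trivial. -/
def IsFreeAction : Prop :=
  ∀ (x : X) (g : G), x <• g = x → g = 1

/-- The right action of `G` on `X` is proper: the map `X × G → X × X`, `(x, g) ↦ (x, x · g)` is
proper. -/
def IsProperAction : Prop :=
  IsProperMap (fun q : X × G => (q.1, q.1 <• q.2))

/-- The orbit space `X/G`; as a quotient of `X`, it carries the quotient topology. -/
abbrev OrbitSpace : Type u := MulAction.orbitRel.Quotient Gᵐᵒᵖ X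

/-- The canonical projection `X → X/G`. -/
def orbitProj : X → OrbitSpace X G := Quotient.mk _

end Actions

/-- The map `π : P → S` is a holomorphic (right) principal `G`-bundle: `G` acts holomorphically on
`P`, the holomorphic map `π` is `G`-invariant, and locally on `S` there are biholomorphisms
`π⁻¹(U) ≃ U × G` over `U` that are equivariant, where `G` acts on `U × G` by right translation on
the second factor. -/
structure IsPrincipalBundle (G : AnMfd.{u}) [Group G] {P S : AnMfd.{u}} [MulAction Gᵐᵒᵖ P]
    (π : P → S) : Prop where
  holomorphic_action : IsHolomorphicAction P G
  holomorphic_proj : ContMDiff P.I S.I ω π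
  proj_act : ∀ (p : P) (g : G), π (p <• g) = π p
  locally_trivial : ∀ s : S, ∃ e : Bundle.Trivialization G π, s ∈ e.baseSet ∧
    ContMDiffOn P.I (S.I.prod G.I) ω e e.source ∧
    ContMDiffOn (S.I.prod G.I) P.I ω e.toOpenPartialHomeomorph.symm e.target ∧
    ∀ p ∈ e.source, ∀ g : G, e (p <• g) = ((e p).1, (e p).2 * g)

section QuotientStack

variable (X G : AnMfd.{u}) [Group G] [MulAction Gᵐᵒᵖ X]

/-- An object of the quotient stack `[X/G]`: a principal `G`-bundle `P → S` together with a
`G`-equivariant holomorphic map `u : P → X`. -/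
structure OrbitFamily : Type (u + 1) where
  /-- The base of the family. -/
  base : AnMfd.{u}
  /-- The total space of the principal bundle. -/
  total : AnMfd.{u}
  [action : MulAction Gᵐᵒᵖ total]
  /-- The bundle projection. -/
  proj : total ⟶ base
  isPrincipalBundle : IsPrincipalBundle G proj
  /-- The equivariant map to `X`. -/
  toX : total ⟶ X
  toX_act : ∀ (p : total) (g : G), toX (p <• g) = toX p <• g

attribute [instance] OrbitFamily.action

namespace OrbitFamily

variable {X G}

/-- A morphism `(Q → T, v) ⟶ (P → S, u)` in `[X/G]` over a holomorphic map `T ⟶ S`: an equivariant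
holomorphic map `Q ⟶ P` that covers `T ⟶ S` (so that it identifies `Q` with the pullback of `P`)
and commutes with the maps to `X`. Over `𝟙 S` these are the isomorphisms of principal bundles
compatible with the maps to `X`. -/
@[ext]
structure Hom (Q P : OrbitFamily X G) : Type u where
  /-- The map between the bases. -/
  onBase : Q.base ⟶ P.base
  /-- The map between the total spaces. -/
  onTotal : Q.total ⟶ P.total
  onTotal_act : ∀ (q : Q.total) (g : G), onTotal (q <• g) = onTotal q <• g
  comm_proj : onTotal ≫ P.proj = Q.proj ≫ onBase
  comm_toX : onTotal ≫ P.toX = Q.toX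

noncomputable instance : Category.{u} (OrbitFamily X G) where
  Hom := Hom
  id P := ⟨𝟙 _, 𝟙 _, fun _ _ => rfl, rfl, rfl⟩
  comp a b := ⟨a.onBase ≫ b.onBase, a.onTotal ≫ b.onTotal,
    fun q g => (congrArg b.onTotal (a.onTotal_act q g)).trans (b.onTotal_act _ g),
    by rw [Category.assoc, b.comm_proj, ← Category.assoc, a.comm_proj, Category.assoc],
    by rw [Category.assoc, b.comm_toX, a.comm_toX]⟩

variable (X G)

/-- The functor that sends a family to its base. -/
noncomputable def toBase : OrbitFamily X G ⥤ AnMfd.{u} where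
  obj P := P.base
  map a := a.onBase

/-- A principal `G`-bundle `X → M` with total space `X`, together with the identity map of `X`. -/
noncomputable def ofTotalX {M : AnMfd.{u}} {π : X → M} (h : IsPrincipalBundle G π) : OrbitFamily X G where
  base := M
  total := X
  proj := ⟨π, h.holomorphic_proj⟩
  isPrincipalBundle := h
  toX := 𝟙 X
  toX_act _ _ := rfl

end OrbitFamily

/-- The quotient stack `[X/G]`, as a category over the category of complex analytic manifolds. Its
fibre over `S` is the groupoid of pairs of a principal `G`-bundle `P → S` and a `G`-equivariant
holomorphic map `P → X`, and it encodes the pullback of such pairs along maps `T ⟶ S`. -/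
noncomputable def quotientStack : BasedCategory.{u, u + 1} AnMfd.{u} :=
  BasedCategory.ofFunctor (OrbitFamily.toBase X G)

end QuotientStack

/-! If `[X/G]` is equivalent to the stack of `M`, the terminal object `𝟙 M` of `Over M` goes to a
terminal object `(P → S, u)` of the total category of families. Morphisms to it from the trivial
family `T × G`, with map `(t, g) ↦ f t · g`, come from the holomorphic lifts `k : T → P` of `f : T →
X` through `u`. So every `f` has exactly one lift, and `u` is an equivariant isomorphism
(`isIso_toX_of_isTerminal`). The action on a principal bundle is free, and it is proper because the
base is Hausdorff; both properties are transported along `u`.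

Conversely, let the action be free and proper. The orbit maps are immersions
(`fderiv_orbit_injective`), so the inverse function theorem gives local coordinates `(w, g) ↦ sec w
· g` near each point. Properness makes this map injective on all of `W × G` once `W` is small
(`exists_localSlice`). The slices are charts of `X/G`, the closed orbit relation makes `X/G`
Hausdorff, and `X → X/G` becomes a principal bundle.

Finally, any principal bundle `π : X → M` with total space `X` makes `M` a fine moduli space. For a
family `(Q → S, u)`, the invariant map `π ∘ u` descends to `S → M`; in the other direction, `f : S →
M` gives the pullback of `X` with its projection to `X`. The comparison of `Q` with this pullback
covers an identity, and such a morphism of principal bundles is invertible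
(`isIso_of_isIso_onBase`). -/

/-! ### Products of complex manifolds -/

namespace AnMfd

/-- The product of two complex analytic manifolds. -/
noncomputable def prod (M N : AnMfd.{u}) : AnMfd.{u} where
  carrier := M × N
  Model := M.Model × N.Model
  chartedSpace := prodChartedSpace M.Model M N.Model N
  isManifold := by
    rw [modelWithCornersSelf_prod]
    exact IsManifold.prod M N

/-- A point of the product of two manifolds. -/
abbrev pair {M N : AnMfd.{u}} (x : M) (y : N) : M.prod N := (x, y)

section Prod

variable {E : Type*} [NormedAddCommGroup E] [NormedSpace ℂ E] {H : Type*} [TopologicalSpace H]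
  {J : ModelWithCorners ℂ E H} {L : Type*} [TopologicalSpace L] [ChartedSpace H L]
  {M N : AnMfd.{u}} {s : Set L} {x : L}

/-- The bundled product uses the model `𝓘(ℂ, E × F)`, while the product lemmas use `𝓘(ℂ, E).prod
𝓘(ℂ, F)`. This lemma and the next ones pass between the two. -/
lemma contMDiffWithinAt_toProd_iff {f : L → M.prod N} :
    ContMDiffWithinAt J (M.prod N).I ω f s x ↔
      ContMDiffWithinAt J (M.I.prod N.I) (M' := M × N) ω f s x := by
  have h : (M.prod N).I = M.I.prod N.I := modelWithCornersSelf_prod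
  rw [h]
  rfl

lemma contMDiffWithinAt_ofProd_iff {f : M.prod N → L} {s : Set (M.prod N)} {x : M.prod N} :
    ContMDiffWithinAt (M.prod N).I J ω f s x ↔
      ContMDiffWithinAt (M.I.prod N.I) J (M := M × N) ω f s x := by
  have h : (M.prod N).I = M.I.prod N.I := modelWithCornersSelf_prod
  rw [h]
  rfl

lemma contMDiffOn_toProd_iff {f : L → M.prod N} :
    ContMDiffOn J (M.prod N).I ω f s ↔ ContMDiffOn J (M.I.prod N.I) (M' := M × N) ω f s :=
  forall₂_congr fun _ _ => contMDiffWithinAt_toProd_iff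

lemma contMDiffOn_ofProd_iff {f : M.prod N → L} {s : Set (M.prod N)} :
    ContMDiffOn (M.prod N).I J ω f s ↔ ContMDiffOn (M.I.prod N.I) J (M := M × N) ω f s :=
  forall₂_congr fun _ _ => contMDiffWithinAt_ofProd_iff

lemma contMDiff_toProd_iff {f : L → M.prod N} :
    ContMDiff J (M.prod N).I ω f ↔ ContMDiff J (M.I.prod N.I) (M' := M × N) ω f :=
  forall_congr' fun _ => contMDiffWithinAt_toProd_iff

lemma contMDiff_ofProd_iff {f : M.prod N → L} :
    ContMDiff (M.prod N).I J ω f ↔ ContMDiff (M.I.prod N.I) J (M := M × N) ω f :=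
  forall_congr' fun _ => contMDiffWithinAt_ofProd_iff

end Prod

lemma hom_contMDiff {M N : AnMfd.{u}} (f : M ⟶ N) : ContMDiff M.I N.I ω f :=
  ContMDiffMap.contMDiff f

lemma hom_ext {M N : AnMfd.{u}} {f g : M ⟶ N} (h : ∀ x, f x = g x) : f = g :=
  ContMDiffMap.ext h

end AnMfd

/-! ### Gluing a manifold structure from local homeomorphisms -/

section Glue

variable {E : Type*} [NormedAddCommGroup E] [NormedSpace ℂ E]
  {N : Type*} [TopologicalSpace N] [ChartedSpace E N] [IsManifold 𝓘(ℂ, E) ω N]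
  {Z : Type*} [TopologicalSpace Z]

/-- A topological space with local homeomorphisms to a manifold `N` and analytic transition
functions is a manifold for which these local homeomorphisms are analytic in both directions. -/
theorem exists_isManifold_of_openPartialHomeomorph (e : Z → OpenPartialHomeomorph Z N)
    (mem : ∀ z, z ∈ (e z).source)
    (compat : ∀ z w, ContMDiffOn 𝓘(ℂ, E) 𝓘(ℂ, E) ω (e w ∘ (e z).symm)
      ((e z).symm ≫ₕ e w).source) :
    ∃ (_ : ChartedSpace E Z) (_ : IsManifold 𝓘(ℂ, E) ω Z), ∀ z,
      ContMDiffOn 𝓘(ℂ, E) 𝓘(ℂ, E) ω (e z) (e z).source ∧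
      ContMDiffOn 𝓘(ℂ, E) 𝓘(ℂ, E) ω (e z).symm (e z).target := by
  -- The chart at `z` is `e z` followed by the chart of `N` at `e z z`.
  let cs : ChartedSpace E Z :=
    { atlas := Set.range fun z => e z ≫ₕ chartAt E (e z z)
      chartAt := fun z => e z ≫ₕ chartAt E (e z z)
      mem_chart_source := fun z => by simp [mem z]
      chart_mem_atlas := fun z => ⟨z, rfl⟩ }
  have man : IsManifold 𝓘(ℂ, E) ω Z := by
    apply isManifold_of_contDiffOn
    rintro _ _ ⟨z, rfl⟩ ⟨w, rfl⟩
    rw [← contMDiffOn_iff_contDiffOn]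
    intro y hy
    simp only [modelWithCornersSelf_coe_symm, Set.preimage_id, modelWithCornersSelf_coe,
      Set.range_id, Set.inter_univ] at hy
    have hy' : ((y ∈ (chartAt E (e z z)).target ∧ (chartAt E (e z z)).symm y ∈ (e z).target) ∧
      (e z).symm ((chartAt E (e z z)).symm y) ∈ (e w).source ∧
      e w ((e z).symm ((chartAt E (e z z)).symm y)) ∈ (chartAt E (e w w)).source) := by
      simpa using hy
    obtain ⟨⟨h1, h2⟩, h3, h4⟩ := hy'
    apply ContMDiffAt.contMDiffWithinAt
    have a1 : ContMDiffAt 𝓘(ℂ, E) 𝓘(ℂ, E) ω (chartAt E (e z z)).symm y :=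
      (contMDiffOn_chart_symm (I := 𝓘(ℂ, E)) (n := ω)).contMDiffAt
        ((chartAt E (e z z)).open_target.mem_nhds h1)
    have a2 : ContMDiffAt 𝓘(ℂ, E) 𝓘(ℂ, E) ω (e w ∘ (e z).symm) ((chartAt E (e z z)).symm y) :=
      (compat z w).contMDiffAt (((e z).symm ≫ₕ e w).open_source.mem_nhds (by simp [h2, h3]))
    have a3 : ContMDiffAt 𝓘(ℂ, E) 𝓘(ℂ, E) ω (chartAt E (e w w))
        ((e w ∘ (e z).symm) ((chartAt E (e z z)).symm y)) :=
      (contMDiffOn_chart (I := 𝓘(ℂ, E)) (n := ω)).contMDiffAt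
        ((chartAt E (e w w)).open_source.mem_nhds h4)
    exact (show ContMDiffAt 𝓘(ℂ, E) 𝓘(ℂ, E) ω (chartAt E (e w w) ∘ (e w ∘ (e z).symm) ∘
      (chartAt E (e z z)).symm) y from a3.comp y (a2.comp y a1))
  -- At its own centre, `e w` is a chart of `Z` followed by an inverse chart of `N`. Other points
  -- are reached afterwards through the transition maps.
  have key : ∀ w, ContMDiffAt 𝓘(ℂ, E) 𝓘(ℂ, E) ω (e w) w := by
    intro w
    have b1 : ContMDiffAt 𝓘(ℂ, E) 𝓘(ℂ, E) ω (chartAt E w : OpenPartialHomeomorph Z E) w :=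
      (contMDiffOn_chart (I := 𝓘(ℂ, E)) (n := ω)).contMDiffAt
        ((chartAt E w).open_source.mem_nhds (mem_chart_source E w))
    have b2 : ContMDiffAt 𝓘(ℂ, E) 𝓘(ℂ, E) ω (chartAt E (e w w)).symm (chartAt E w w) :=
      (contMDiffOn_chart_symm (I := 𝓘(ℂ, E)) (n := ω)).contMDiffAt
        ((chartAt E (e w w)).open_target.mem_nhds (mem_chart_target E (e w w)))
    refine (b2.comp w b1).congr_of_eventuallyEq ?_
    filter_upwards [(chartAt E w).open_source.mem_nhds (mem_chart_source E w)] with y hy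
    have hy' : y ∈ (e w).source ∧ e w y ∈ (chartAt E (e w w)).source := by
      have : y ∈ (e w ≫ₕ chartAt E (e w w)).source := hy
      simpa using this
    exact ((chartAt E (e w w)).left_inv hy'.2).symm
  have key' : ∀ w, ContMDiffAt 𝓘(ℂ, E) 𝓘(ℂ, E) ω (e w).symm (e w w) := by
    intro w
    have b1 : ContMDiffAt 𝓘(ℂ, E) 𝓘(ℂ, E) ω (chartAt E (e w w)) (e w w) :=
      (contMDiffOn_chart (I := 𝓘(ℂ, E)) (n := ω)).contMDiffAt
        ((chartAt E (e w w)).open_source.mem_nhds (mem_chart_source E (e w w)))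
    have b2 : ContMDiffAt 𝓘(ℂ, E) 𝓘(ℂ, E) ω (chartAt E w : OpenPartialHomeomorph Z E).symm
        (chartAt E (e w w) (e w w)) :=
      (contMDiffOn_chart_symm (I := 𝓘(ℂ, E)) (n := ω)).contMDiffAt
        ((chartAt E w).open_target.mem_nhds (mem_chart_target E w))
    refine (b2.comp _ b1).congr_of_eventuallyEq ?_
    filter_upwards [(chartAt E (e w w)).open_source.mem_nhds (mem_chart_source E (e w w))]
      with y hy
    exact (congrArg (e w).symm ((chartAt E (e w w)).left_inv hy)).symm
  refine ⟨cs, man, fun z => ⟨fun w hw => ?_, fun n hn => ?_⟩⟩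
  · apply ContMDiffAt.contMDiffWithinAt
    have a2 : ContMDiffAt 𝓘(ℂ, E) 𝓘(ℂ, E) ω (e z ∘ (e w).symm) (e w w) :=
      (compat w z).contMDiffAt (((e w).symm ≫ₕ e z).open_source.mem_nhds (by simp [mem w, hw]))
    refine (a2.comp w (key w)).congr_of_eventuallyEq ?_
    filter_upwards [(e w).open_source.mem_nhds (mem w)] with y hy
    exact (congrArg (e z) ((e w).left_inv hy)).symm
  · apply ContMDiffAt.contMDiffWithinAt
    set w := (e z).symm n with hw
    have hwz : w ∈ (e z).source := (e z).map_target hn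
    have a2 : ContMDiffAt 𝓘(ℂ, E) 𝓘(ℂ, E) ω (e w ∘ (e z).symm) n :=
      (compat z w).contMDiffAt
        (((e z).symm ≫ₕ e w).open_source.mem_nhds (by simp [hn, ← hw, mem w]))
    refine (ContMDiffAt.comp n (f := e w ∘ (e z).symm) (key' w) a2).congr_of_eventuallyEq ?_
    filter_upwards [(((e z).symm ≫ₕ e w).open_source.mem_nhds
      (show n ∈ _ by simp [hn, ← hw, mem w]))] with y hy
    have hy' : y ∈ (e z).target ∧ (e z).symm y ∈ (e w).source := by simpa using hy
    exact ((e w).left_inv hy'.2).symm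

end Glue

/-! ### Principal bundles through local sections: freeness, descent, properness -/

section PrincipalChart

variable (G : AnMfd.{u}) [Group G] {P S : AnMfd.{u}} [MulAction Gᵐᵒᵖ P]

/-- A local trivialisation of a principal bundle, given by a local holomorphic section `sec` over
`U` and the fibre coordinate `coord` that it determines. -/
structure PrincipalChart (π : P → S) where
  /-- The open subset of the base. -/
  U : Set S
  isOpen_U : IsOpen U
  /-- The section. -/
  sec : S → P
  /-- The fibre coordinate. -/
  coord : P → G
  contMDiffOn_sec : ContMDiffOn S.I P.I ω sec U
  contMDiffOn_coord : ContMDiffOn P.I G.I ω coord (π ⁻¹' U)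
  proj_sec : ∀ s ∈ U, π (sec s) = s
  coord_sec : ∀ s ∈ U, coord (sec s) = 1
  coord_act : ∀ p (g : G), π p ∈ U → coord (p <• g) = coord p * g
  sec_coord : ∀ p, π p ∈ U → sec (π p) <• coord p = p

variable {G}

lemma right_act_mul {Y : Type*} [MulAction Gᵐᵒᵖ Y] (y : Y) (g h : G) :
    y <• (g * h) = (y <• g) <• h := by
  rw [MulOpposite.op_mul, mul_smul]

lemma right_act_one {Y : Type*} [MulAction Gᵐᵒᵖ Y] (y : Y) : y <• (1 : G) = y := by
  rw [MulOpposite.op_one, one_smul]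

/-- Both points are translates of the same value of the section. This gives a formula, holomorphic
in `p` and `q`, for the group element that carries one point of a fibre to another. -/
lemma PrincipalChart.act_inv_coord_mul {π : P → S} (χ : PrincipalChart G π) {p q : P}
    (hp : π p ∈ χ.U) (hpq : π p = π q) : p <• ((χ.coord p)⁻¹ * χ.coord q) = q := by
  have h1 := χ.sec_coord p hp
  have h2 := χ.sec_coord q (hpq ▸ hp)
  rw [← hpq] at h2
  calc p <• ((χ.coord p)⁻¹ * χ.coord q)
      = (χ.sec (π p) <• χ.coord p) <• ((χ.coord p)⁻¹ * χ.coord q) := by rw [h1]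
    _ = q := by rw [← right_act_mul, mul_inv_cancel_left, h2]

namespace IsPrincipalBundle

variable {π : P → S}

/-- The section is the unit section of the trivialisation, and equivariance recovers the rest from
it. `of_charts` is the converse, with trivialisation inverse to `(s, g) ↦ sec s · g`. -/
lemma exists_chart (h : IsPrincipalBundle G π) (s : S) :
    ∃ χ : PrincipalChart G π, s ∈ χ.U := by
  obtain ⟨e, hs, h1, h2, h3⟩ := h.locally_trivial s
  have htgt : ∀ t ∈ e.baseSet, ∀ g : G, (t, g) ∈ e.target := fun t ht g => e.mem_target.2 ht
  have hr : ∀ t ∈ e.baseSet, ∀ g : G, e (e.toOpenPartialHomeomorph.symm (t, g)) = (t, g) :=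
    fun t ht g => e.apply_symm_apply (htgt t ht g)
  have hsrc : ∀ t ∈ e.baseSet, ∀ g : G, e.toOpenPartialHomeomorph.symm (t, g) ∈ e.source :=
    fun t ht g => e.toOpenPartialHomeomorph.map_target (htgt t ht g)
  refine ⟨⟨e.baseSet, e.open_baseSet, fun t => e.toOpenPartialHomeomorph.symm (t, 1),
    fun p => (e p).2, ?_, ?_, ?_, ?_, ?_, ?_⟩, hs⟩
  · refine ContMDiffOn.comp (t := e.target) h2 ?_ (fun t ht => htgt t ht 1)
    exact contMDiffOn_id.prodMk contMDiffOn_const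
  · rw [← e.source_eq]
    exact contMDiff_snd.comp_contMDiffOn h1
  · intro t ht
    rw [← e.coe_fst (hsrc t ht 1), hr t ht]
  · intro t ht
    exact congrArg Prod.snd (hr t ht 1)
  · intro p g hp
    rw [h3 p (e.mem_source.2 hp)]
  · intro p hp
    have hpg : e.toOpenPartialHomeomorph.symm (π p, 1) <• (e p).2 ∈ e.source := by
      rw [e.mem_source, h.proj_act, ← e.mem_source]
      exact hsrc _ hp 1
    refine e.injOn hpg (e.mem_source.2 hp) ?_
    change e _ = e _
    rw [h3 _ (hsrc _ hp 1), hr _ hp, one_mul, ← e.coe_fst (e.mem_source.2 hp)]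

lemma of_charts (h1 : IsHolomorphicAction P G) (h2 : ContMDiff P.I S.I ω π)
    (h3 : ∀ (p : P) (g : G), π (p <• g) = π p)
    (h4 : ∀ s : S, ∃ χ : PrincipalChart G π, s ∈ χ.U) : IsPrincipalBundle G π where
  holomorphic_action := h1
  holomorphic_proj := h2
  proj_act := h3
  locally_trivial s := by
    obtain ⟨χ, hs⟩ := h4 s
    have k1 : ContMDiffOn P.I (S.I.prod G.I) ω (fun p => (π p, χ.coord p)) (π ⁻¹' χ.U) :=
      h2.contMDiffOn.prodMk χ.contMDiffOn_coord
    have k2 : ContMDiffOn (S.I.prod G.I) P.I ω (fun q : S × G => χ.sec q.1 <• q.2)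
        (χ.U ×ˢ Set.univ) :=
      h1.comp_contMDiffOn
        ((χ.contMDiffOn_sec.comp contMDiffOn_fst (fun q hq => hq.1)).prodMk contMDiffOn_snd)
    refine ⟨{
      toFun := fun p => (π p, χ.coord p)
      invFun := fun q => χ.sec q.1 <• q.2
      source := π ⁻¹' χ.U
      target := χ.U ×ˢ Set.univ
      map_source' := fun p hp => ⟨hp, trivial⟩
      map_target' := fun q hq => by
        rw [Set.mem_preimage, h3, χ.proj_sec _ hq.1]; exact hq.1
      left_inv' := fun p hp => χ.sec_coord p hp
      right_inv' := fun q hq => by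
        have hq1 := χ.proj_sec _ hq.1
        ext
        · rw [h3, hq1]
        · rw [χ.coord_act _ _ (by rw [hq1]; exact hq.1), χ.coord_sec _ hq.1, one_mul]
      open_source := χ.isOpen_U.preimage h2.continuous
      open_target := χ.isOpen_U.prod isOpen_univ
      continuousOn_toFun := k1.continuousOn
      continuousOn_invFun := k2.continuousOn
      baseSet := χ.U
      open_baseSet := χ.isOpen_U
      source_eq := rfl
      target_eq := rfl
      proj_toFun := fun _ _ => rfl }, hs, k1, k2, fun p hp g => ?_⟩
    exact Prod.ext (h3 p g) (χ.coord_act p g hp)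

lemma surjective (h : IsPrincipalBundle G π) : Function.Surjective π := fun s => by
  obtain ⟨χ, hs⟩ := h.exists_chart s
  exact ⟨_, χ.proj_sec s hs⟩

lemma isFreeAction (h : IsPrincipalBundle G π) : IsFreeAction P G := fun p g hg => by
  obtain ⟨χ, hs⟩ := h.exists_chart (π p)
  have := χ.coord_act p g hs
  rw [hg] at this
  exact left_eq_mul.1 this

lemma exists_act_eq (h : IsPrincipalBundle G π) {p q : P} (hpq : π p = π q) :
    ∃ g : G, p <• g = q := by
  obtain ⟨χ, hs⟩ := h.exists_chart (π p)
  exact ⟨_, χ.act_inv_coord_mul hs hpq⟩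

/-- An invariant holomorphic map on the total space of a principal bundle descends to the base. -/
lemma exists_descent (h : IsPrincipalBundle G π) {Y : AnMfd.{u}} (f : P ⟶ Y)
    (hf : ∀ (p : P) (g : G), f (p <• g) = f p) : ∃ k : S ⟶ Y, ∀ p, k (π p) = f p := by
  choose r hr using h.surjective
  have hk : ∀ p, f (r (π p)) = f p := fun p => by
    obtain ⟨g, hg⟩ := h.exists_act_eq (hr (π p))
    exact (hf _ g).symm.trans (congrArg f hg)
  refine ⟨⟨fun s => f (r s), fun s => ?_⟩, hk⟩
  -- The choice `r` of preimages need not be continuous, but near `s` the descended map equals `f ∘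
  -- χ.sec`.
  obtain ⟨χ, hs⟩ := h.exists_chart s
  have h1 : ContMDiffAt S.I Y.I ω (fun t => f (χ.sec t)) s :=
    (AnMfd.hom_contMDiff f _).comp s (χ.contMDiffOn_sec.contMDiffAt (χ.isOpen_U.mem_nhds hs))
  refine h1.congr_of_eventuallyEq ?_
  filter_upwards [χ.isOpen_U.mem_nhds hs] with t ht
  rw [← hk (χ.sec t), χ.proj_sec t ht]

/-- The action on the total space of a principal bundle over a Hausdorff base is proper. -/
lemma isProperAction [LieGroup G.I ω G] (h : IsPrincipalBundle G π) : IsProperAction P G := by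
  have : IsTopologicalGroup G := topologicalGroup_of_lieGroup G.I ω
  rw [IsProperAction, isProperMap_iff_ultrafilter]
  have hc : Continuous (fun q : P × G => q.1 <• q.2) := h.holomorphic_action.continuous
  have hπ := h.holomorphic_proj.continuous
  refine ⟨continuous_fst.prodMk hc, fun 𝒰 y hy => ?_⟩
  obtain ⟨p, q⟩ := y
  rw [nhds_prod_eq, Filter.tendsto_prod_iff'] at hy
  obtain ⟨hp, hq⟩ := hy
  -- Along the ultrafilter `(p', p' · g) → (p, q)`. As `S` is Hausdorff, the limits lie in one
  -- fibre.
  have hpq : π p = π q := by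
    refine tendsto_nhds_unique ((hπ.tendsto p).comp hp) (((hπ.tendsto q).comp hq).congr ?_)
    exact fun z => h.proj_act _ _
  obtain ⟨χ, hs⟩ := h.exists_chart (π p)
  have hopen : IsOpen (π ⁻¹' χ.U) := χ.isOpen_U.preimage hπ
  have cp : ContinuousAt χ.coord p :=
    χ.contMDiffOn_coord.continuousOn.continuousAt (hopen.mem_nhds hs)
  have cq : ContinuousAt χ.coord q :=
    χ.contMDiffOn_coord.continuousOn.continuousAt (hopen.mem_nhds (hpq ▸ hs : π q ∈ χ.U))
  -- The group component is `(coord p')⁻¹ * coord (p' · g)`, so it converges because both factors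
  -- do.
  have ht : Filter.Tendsto Prod.snd (𝒰 : Filter (P × G)) (nhds ((χ.coord p)⁻¹ * χ.coord q)) := by
    refine ((cp.tendsto.comp hp).inv.mul (cq.tendsto.comp hq)).congr' ?_
    filter_upwards [hp.eventually (hopen.mem_nhds hs)] with z hz
    simp only [Function.comp_apply]
    rw [χ.coord_act _ _ hz, inv_mul_cancel_left]
  have hact : p <• ((χ.coord p)⁻¹ * χ.coord q) = q :=
    χ.act_inv_coord_mul hs hpq
  refine ⟨(p, (χ.coord p)⁻¹ * χ.coord q), Prod.ext rfl hact, ?_⟩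
  rw [nhds_prod_eq]
  exact Filter.tendsto_id'.1 (Filter.tendsto_id.mono_left (Filter.le_prod.2 ⟨hp, ht⟩))

end IsPrincipalBundle

end PrincipalChart

/-! ### A fine moduli space forces the action to be free and proper -/

section EquivalenceOfBasedCategories

variable {𝒮 : Type*} [Category 𝒮] {𝒳 𝒴 : BasedCategory 𝒮}

/-- The equivalence of categories underlying an equivalence of categories over a base. -/
def basedEquivalenceToEquivalence (e : Bicategory.Equivalence 𝒳 𝒴) : 𝒳.obj ≌ 𝒴.obj :=
  CategoryTheory.Equivalence.mk (BasedFunctor.toFunctor e.hom) (BasedFunctor.toFunctor e.inv)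
    ((BasedNatTrans.forgetful 𝒳 𝒳).mapIso e.unit) ((BasedNatTrans.forgetful 𝒴 𝒴).mapIso e.counit)

end EquivalenceOfBasedCategories

section Terminal

variable {X G : AnMfd.{u}} [Group G] [MulAction Gᵐᵒᵖ X]

/-- The object that an equivalence with the stack of `M` attaches to the identity of `M` is
terminal. -/
noncomputable def isTerminalInvObjId {M : AnMfd.{u}}
    (e : Bicategory.Equivalence (quotientStack X G) M.stack) :
    Limits.IsTerminal (C := OrbitFamily X G)
      ((BasedFunctor.toFunctor e.inv).obj (Over.mk (𝟙 M))) :=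
  Limits.IsTerminal.isTerminalObj (basedEquivalenceToEquivalence e).inverse
    (Over.mk (𝟙 M)) Over.mkIdTerminal

end Terminal

namespace AnMfd

/-- Right translation on the second factor of a product. -/
@[reducible]
def mulActionProd (S G : AnMfd.{u}) [Group G] : MulAction Gᵐᵒᵖ (S.prod G) where
  smul g p := ((p.1, p.2 * g.unop) : S × G)
  one_smul p := Prod.ext rfl (mul_one p.2)
  mul_smul g h p := Prod.ext rfl (mul_assoc p.2 h.unop g.unop).symm

end AnMfd

namespace OrbitFamily

variable {X G : AnMfd.{u}} [Group G] [LieGroup G.I ω G] [MulAction Gᵐᵒᵖ X]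

/-- The trivial bundle `S × G → S` with the equivariant map `(s, g) ↦ f s · g`. -/
noncomputable def trivial (hact : IsHolomorphicAction X G) {S : AnMfd.{u}} (f : S ⟶ X) :
    OrbitFamily X G :=
  letI := S.mulActionProd G
  { base := S
    total := S.prod G
    proj := ⟨fun p => p.1, AnMfd.contMDiff_ofProd_iff.2 contMDiff_fst⟩
    isPrincipalBundle := by
      refine IsPrincipalBundle.of_charts ?_ (AnMfd.contMDiff_ofProd_iff.2 contMDiff_fst)
        (fun p g => rfl) (fun s => ⟨⟨Set.univ, isOpen_univ, fun s => ((s, 1) : S × G), fun p => p.2,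
        ?_, ?_, fun _ _ => rfl, fun _ _ => rfl, fun _ _ _ => rfl, fun p _ => ?_⟩, Set.mem_univ s⟩)
      · refine AnMfd.contMDiff_toProd_iff.2 ?_
        have h : ContMDiff ((S.prod G).I.prod G.I) (S.I.prod G.I) ω
            (fun q : S.prod G × G => ((q.1.1, q.1.2) : S × G)) :=
          (AnMfd.contMDiff_toProd_iff.1 contMDiff_id).comp contMDiff_fst
        exact (contMDiff_fst.comp h).prodMk ((contMDiff_snd.comp h).mul contMDiff_snd)
      · exact (AnMfd.contMDiff_toProd_iff.2 (contMDiff_id.prodMk contMDiff_const)).contMDiffOn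
      · exact (AnMfd.contMDiff_ofProd_iff.2 contMDiff_snd).contMDiffOn
      · exact Prod.ext rfl (one_mul p.2)
    toX := ⟨fun p => f p.1 <• p.2, by
      have h : ContMDiff (S.I.prod G.I) X.I ω (fun p : S × G => f p.1 <• p.2) :=
        hact.comp (((AnMfd.hom_contMDiff f).comp contMDiff_fst).prodMk contMDiff_snd)
      exact AnMfd.contMDiff_ofProd_iff.2 h⟩
    toX_act := fun p g => right_act_mul (f p.1) p.2 g }

/-- A morphism from a trivial family to `U`, given by a holomorphic map to the total space. -/
noncomputable def trivialHom (hact : IsHolomorphicAction X G) {S : AnMfd.{u}} (f : S ⟶ X)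
    (U : OrbitFamily X G) (k : S ⟶ U.total) (hk : k ≫ U.toX = f) : trivial hact f ⟶ U where
  onBase := k ≫ U.proj
  onTotal := ⟨fun p => k p.1 <• p.2, by
    have h : ContMDiff (S.I.prod G.I) U.total.I ω (fun p : S × G => k p.1 <• p.2) :=
      U.isPrincipalBundle.holomorphic_action.comp
        (((AnMfd.hom_contMDiff k).comp contMDiff_fst).prodMk contMDiff_snd)
    exact AnMfd.contMDiff_ofProd_iff.2 h⟩
  onTotal_act := fun q g => right_act_mul (k q.1) q.2 g
  comm_proj := AnMfd.hom_ext fun q => U.isPrincipalBundle.proj_act (k q.1) q.2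
  comm_toX := AnMfd.hom_ext fun q =>
    (U.toX_act (k q.1) q.2).trans (congrArg (fun φ : S ⟶ X => φ q.1 <• q.2) hk)

/-- The holomorphic map to the total space that a morphism from a trivial family determines. -/
noncomputable def ofTrivialHom (hact : IsHolomorphicAction X G) {S : AnMfd.{u}} (f : S ⟶ X)
    (U : OrbitFamily X G) (a : trivial hact f ⟶ U) : S ⟶ U.total :=
  (⟨fun s => ((s, 1) : S × G),
    AnMfd.contMDiff_toProd_iff.2 (contMDiff_id.prodMk contMDiff_const)⟩ : S ⟶ S.prod G) ≫
    (Hom.onTotal a)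

lemma ofTrivialHom_toX (hact : IsHolomorphicAction X G) {S : AnMfd.{u}} (f : S ⟶ X)
    (U : OrbitFamily X G) (a : trivial hact f ⟶ U) : ofTrivialHom hact f U a ≫ U.toX = f :=
  AnMfd.hom_ext fun s =>
    (congrArg (fun φ : S.prod G ⟶ X => φ ((s, 1) : S × G)) (Hom.comm_toX a)).trans
      (right_act_one (f s))

/-- This one-sided inverse is enough: it turns uniqueness of morphisms to a terminal family into
uniqueness of lifts through `toX`. -/
lemma ofTrivialHom_trivialHom (hact : IsHolomorphicAction X G) {S : AnMfd.{u}} (f : S ⟶ X)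
    (U : OrbitFamily X G) (k : S ⟶ U.total) (hk : k ≫ U.toX = f) :
    ofTrivialHom hact f U (trivialHom hact f U k hk) = k :=
  AnMfd.hom_ext fun s => right_act_one (k s)

/-- Holomorphic maps to the total space of a terminal family are the same as maps to `X`. -/
lemma eq_of_isTerminal (hact : IsHolomorphicAction X G) {U : OrbitFamily X G}
    (hU : Limits.IsTerminal U) {S : AnMfd.{u}} {k k' : S ⟶ U.total}
    (h : k ≫ U.toX = k' ≫ U.toX) : k = k' := by
  have h1 := ofTrivialHom_trivialHom hact _ U k h
  have h2 := ofTrivialHom_trivialHom hact _ U k' rfl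
  rw [hU.hom_ext (trivialHom hact _ U k h) (trivialHom hact _ U k' rfl)] at h1
  exact h1.symm.trans h2

/-- The lift of `𝟙 X` is a section of `toX`. It is also a left inverse, since its composite with
`toX` on `U.total` and the identity lift the same map. -/
lemma isIso_toX_of_isTerminal (hact : IsHolomorphicAction X G) {U : OrbitFamily X G}
    (hU : Limits.IsTerminal U) : IsIso U.toX := by
  have h := ofTrivialHom_toX hact (𝟙 X) U (hU.from _)
  refine ⟨ofTrivialHom hact (𝟙 X) U (hU.from _), eq_of_isTerminal hact hU ?_, h⟩
  rw [Category.assoc, h, Category.comp_id, Category.id_comp]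

/-- The inverse of the equivariant isomorphism `toX` is equivariant too, so `X` inherits both
properties from the total space of a principal bundle. -/
theorem free_and_proper_of_isTerminal (hact : IsHolomorphicAction X G) {U : OrbitFamily X G}
    (hU : Limits.IsTerminal U) : IsFreeAction X G ∧ IsProperAction X G := by
  obtain ⟨s, hs1, hs2⟩ := isIso_toX_of_isTerminal hact hU
  have us : ∀ x, U.toX (s x) = x := fun x => congrArg (fun φ : X ⟶ X => φ x) hs2
  have su : ∀ p, s (U.toX p) = p := fun p => congrArg (fun φ : U.total ⟶ U.total => φ p) hs1
  have sact : ∀ (x : X) (g : G), s (x <• g) = s x <• g := fun x g => by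
    rw [← su (s x <• g)]
    exact congrArg s ((congrArg (fun y => y <• g) (us x).symm).trans (U.toX_act (s x) g).symm)
  refine ⟨fun x g hg => U.isPrincipalBundle.isFreeAction (s x) g ?_, ?_⟩
  · exact (sact x g).symm.trans (congrArg s hg)
  · let φ : X ≃ₜ U.total :=
      { toFun := s
        invFun := U.toX
        left_inv := us
        right_inv := su
        continuous_toFun := (AnMfd.hom_contMDiff s).continuous
        continuous_invFun := (AnMfd.hom_contMDiff U.toX).continuous }
    have h := ((φ.symm.prodCongr φ.symm).isProperMap.comp
      U.isPrincipalBundle.isProperAction).comp (φ.prodCongr (Homeomorph.refl G)).isProperMap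
    refine (congrArg IsProperMap (funext fun q => ?_)).mp h
    exact Prod.ext (us q.1) ((congrArg U.toX (sact q.1 q.2).symm).trans (us (q.1 <• q.2)))

end OrbitFamily

/-! ### Pullbacks of principal bundles -/

namespace IsPrincipalBundle

variable {G P S B : AnMfd.{u}} [Group G] [MulAction Gᵐᵒᵖ P] {π : P → B}

/-- The fibre product of `S` and `P` over `B`. -/
abbrev FibreProduct (π : P → B) (f : S ⟶ B) : Type u := {q : S × P // f q.1 = π q.2}

lemma sec_act_mem (h : IsPrincipalBundle G π) (f : S ⟶ B) (χ : PrincipalChart G π) {s : S}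
    (hs : f s ∈ χ.U) (g : G) : f s = π (χ.sec (f s) <• g) := by
  rw [h.proj_act, χ.proj_sec _ hs]

open Classical in
/-- The chart of a fibre product given by a local trivialisation of the principal bundle. -/
noncomputable def fibreProductChart (h : IsPrincipalBundle G π) (f : S ⟶ B)
    (χ : PrincipalChart G π) (z₀ : FibreProduct π f) :
    OpenPartialHomeomorph (FibreProduct π f) (S.prod G) where
  toFun z := ((z.1.1, χ.coord z.1.2) : S × G)
  -- The point `z₀` is only a default value outside the target.
  invFun q := if hs : f q.1 ∈ χ.U then ⟨(q.1, χ.sec (f q.1) <• q.2), h.sec_act_mem f χ hs q.2⟩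
    else z₀
  source := {z | f z.1.1 ∈ χ.U}
  target := {q | f q.1 ∈ χ.U}
  map_source' z hz := hz
  map_target' q hq := by
    have hq' : f q.1 ∈ χ.U := hq
    simp only [hq', dite_true, Set.mem_ofPred_eq]
  left_inv' z hz := by
    have hz' : f z.1.1 ∈ χ.U := hz
    have h2 : π z.1.2 ∈ χ.U := z.2 ▸ hz'
    simp only [hz', dite_true]
    refine Subtype.ext (Prod.ext rfl ?_)
    have h3 := χ.sec_coord _ h2
    rw [← z.2] at h3
    exact h3
  right_inv' q hq := by
    have hq' : f q.1 ∈ χ.U := hq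
    simp only [hq', dite_true]
    refine Prod.ext rfl ?_
    have h1 := χ.proj_sec _ hq'
    change χ.coord (χ.sec (f q.1) <• q.2) = q.2
    rw [χ.coord_act _ _ (h1.symm ▸ hq'), χ.coord_sec _ hq', one_mul]
  open_source := χ.isOpen_U.preimage
    ((AnMfd.hom_contMDiff f).continuous.comp (continuous_fst.comp continuous_subtype_val))
  open_target := χ.isOpen_U.preimage
    ((AnMfd.hom_contMDiff f).continuous.comp (continuous_fst (X := S) (Y := G)))
  continuousOn_toFun := by
    refine ContinuousOn.prodMk (f := fun z : FibreProduct π f => z.1.1)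
      (continuous_fst.comp continuous_subtype_val).continuousOn ?_
    exact χ.contMDiffOn_coord.continuousOn.comp
      (continuous_snd.comp continuous_subtype_val).continuousOn
      (fun z hz => by
        have hz' : f z.1.1 ∈ χ.U := hz
        exact (z.2 ▸ hz' : π z.1.2 ∈ χ.U))
  continuousOn_invFun := by
    refine Topology.IsInducing.subtypeVal.continuousOn_iff.2 ?_
    have h1 : ContinuousOn (fun q : S × G => (q.1, χ.sec (f q.1) <• q.2))
        {q : S × G | f q.1 ∈ χ.U} := by
      refine continuousOn_fst.prodMk (h.holomorphic_action.continuous.comp_continuousOn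
        (ContinuousOn.prodMk ?_ continuousOn_snd))
      exact χ.contMDiffOn_sec.continuousOn.comp
        ((AnMfd.hom_contMDiff f).continuous.comp continuous_fst).continuousOn (fun q hq => hq)
    refine ContinuousOn.congr h1 (fun q hq => ?_)
    have hq' : f q.1 ∈ χ.U := hq
    simp only [Function.comp_apply, hq', dite_true]

lemma fibreProductChart_symm_apply (h : IsPrincipalBundle G π) (f : S ⟶ B)
    (χ : PrincipalChart G π) (z₀ : FibreProduct π f) {q : S.prod G} (hq : f q.1 ∈ χ.U) :
    (h.fibreProductChart f χ z₀).symm q =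
      ⟨(q.1, χ.sec (f q.1) <• q.2), h.sec_act_mem f χ hq q.2⟩ :=
  dif_pos hq

lemma contMDiffOn_sec_act (h : IsPrincipalBundle G π) (f : S ⟶ B) (χ : PrincipalChart G π) :
    ContMDiffOn (S.I.prod G.I) P.I ω (fun q : S × G => χ.sec (f q.1) <• q.2)
      {q : S × G | f q.1 ∈ χ.U} :=
  ContMDiff.comp_contMDiffOn (g := fun q : P × G => q.1 <• q.2) h.holomorphic_action
    (ContMDiffOn.prodMk (χ.contMDiffOn_sec.comp
      ((AnMfd.hom_contMDiff f).comp contMDiff_fst).contMDiffOn (fun _ hq => hq)) contMDiffOn_snd)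

/-- A local trivialisation whose base contains the image of a point of the fibre product. -/
noncomputable def chartAtPoint (h : IsPrincipalBundle G π) (f : S ⟶ B) (z : FibreProduct π f) :
    PrincipalChart G π :=
  (h.exists_chart (f z.1.1)).choose

lemma mem_chartAtPoint (h : IsPrincipalBundle G π) (f : S ⟶ B) (z : FibreProduct π f) :
    f z.1.1 ∈ (h.chartAtPoint f z).U :=
  (h.exists_chart (f z.1.1)).choose_spec

/-- The charts identify the fibre product locally with `S × G`, and the transition maps are `(s, g)
↦ (s, χ'.coord (χ.sec (f s) · g))`, hence holomorphic. -/
theorem exists_isManifold_fibreProduct (h : IsPrincipalBundle G π) (f : S ⟶ B) :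
    ∃ (_ : ChartedSpace (S.prod G).Model (FibreProduct π f))
      (_ : IsManifold 𝓘(ℂ, (S.prod G).Model) ω (FibreProduct π f)), ∀ z,
      ContMDiffOn 𝓘(ℂ, (S.prod G).Model) 𝓘(ℂ, (S.prod G).Model) ω
        (h.fibreProductChart f (h.chartAtPoint f z) z)
        (h.fibreProductChart f (h.chartAtPoint f z) z).source ∧
      ContMDiffOn 𝓘(ℂ, (S.prod G).Model) 𝓘(ℂ, (S.prod G).Model) ω
        (h.fibreProductChart f (h.chartAtPoint f z) z).symm
        (h.fibreProductChart f (h.chartAtPoint f z) z).target := by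
  refine exists_isManifold_of_openPartialHomeomorph _ (fun z => h.mem_chartAtPoint f z)
    (fun z w => ?_)
  set χ := h.chartAtPoint f z
  set χ' := h.chartAtPoint f w
  have h1 : ∀ q ∈ ((h.fibreProductChart f χ z).symm ≫ₕ h.fibreProductChart f χ' w).source,
      f q.1 ∈ χ.U ∧ f q.1 ∈ χ'.U := by
    intro q hq
    rw [OpenPartialHomeomorph.trans_source] at hq
    have hq1 : f q.1 ∈ χ.U := hq.1
    have hq2 : f ((h.fibreProductChart f χ z).symm q).1.1 ∈ χ'.U := hq.2
    rw [h.fibreProductChart_symm_apply f χ z hq1] at hq2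
    exact ⟨hq1, hq2⟩
  have h2 : ContMDiffOn (S.I.prod G.I) (S.I.prod G.I) ω
      (fun q : S × G => (q.1, χ'.coord (χ.sec (f q.1) <• q.2)))
      ({q : S × G | f q.1 ∈ χ.U ∧ f q.1 ∈ χ'.U}) := by
    refine contMDiffOn_fst.prodMk (χ'.contMDiffOn_coord.comp
      ((h.contMDiffOn_sec_act f χ).mono fun q hq => hq.1) (fun q hq => ?_))
    change π (χ.sec (f q.1) <• q.2) ∈ χ'.U
    rw [← h.sec_act_mem f χ hq.1]
    exact hq.2
  refine ContMDiffOn.congr (f := fun q : S.prod G =>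
    AnMfd.pair q.1 (χ'.coord (χ.sec (f q.1) <• q.2)))
    ((AnMfd.contMDiffOn_toProd_iff.2 (AnMfd.contMDiffOn_ofProd_iff.2 h2)).mono h1)
    (fun q hq => ?_)
  rw [Function.comp_apply, h.fibreProductChart_symm_apply f χ z (h1 q hq).1]
  rfl

/-- The pullback of a principal bundle, as a complex analytic manifold. -/
noncomputable def pullback (h : IsPrincipalBundle G π) (f : S ⟶ B) : AnMfd.{u} where
  carrier := FibreProduct π f
  Model := (S.prod G).Model
  chartedSpace := (h.exists_isManifold_fibreProduct f).choose
  isManifold := (h.exists_isManifold_fibreProduct f).choose_spec.choose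

variable (h : IsPrincipalBundle G π) (f : S ⟶ B)

lemma contMDiffOn_pullbackChart (z : FibreProduct π f) :
    ContMDiffOn (h.pullback f).I (S.prod G).I (M := h.pullback f) ω
      (h.fibreProductChart f (h.chartAtPoint f z) z)
      (h.fibreProductChart f (h.chartAtPoint f z) z).source :=
  ((h.exists_isManifold_fibreProduct f).choose_spec.choose_spec z).1

lemma contMDiffOn_pullbackChart_symm (z : FibreProduct π f) :
    ContMDiffOn (S.prod G).I (h.pullback f).I (M' := h.pullback f) ω
      (h.fibreProductChart f (h.chartAtPoint f z) z).symm
      (h.fibreProductChart f (h.chartAtPoint f z) z).target :=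
  ((h.exists_isManifold_fibreProduct f).choose_spec.choose_spec z).2

lemma contMDiff_pullback_fst :
    ContMDiff (h.pullback f).I S.I ω (fun z : h.pullback f => z.1.1) := by
  intro z
  have h1 := (h.contMDiffOn_pullbackChart f z).contMDiffAt
    ((h.fibreProductChart f (h.chartAtPoint f z) z).open_source.mem_nhds (h.mem_chartAtPoint f z))
  have h2 : ContMDiff (S.prod G).I S.I ω (fun q : S.prod G => q.1) :=
    AnMfd.contMDiff_ofProd_iff.2 contMDiff_fst
  exact (h2 _).comp z h1

lemma contMDiff_pullback_snd :
    ContMDiff (h.pullback f).I P.I ω (fun z : h.pullback f => z.1.2) := by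
  intro z
  set χ := h.chartAtPoint f z
  have hs := (h.fibreProductChart f χ z).open_source.mem_nhds (h.mem_chartAtPoint f z)
  have h1 := (h.contMDiffOn_pullbackChart f z).contMDiffAt hs
  have h2 : ContMDiffOn (S.prod G).I P.I ω (fun q : S.prod G => χ.sec (f q.1) <• q.2)
      {q : S.prod G | f q.1 ∈ χ.U} :=
    AnMfd.contMDiffOn_ofProd_iff.2 (h.contMDiffOn_sec_act f χ)
  have h3 := h2.contMDiffAt (x := AnMfd.pair z.1.1 (χ.coord z.1.2))
    ((h.fibreProductChart f χ z).open_target.mem_nhds (h.mem_chartAtPoint f z))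
  refine (ContMDiffAt.comp (M := h.pullback f) (I := (h.pullback f).I)
    (f := h.fibreProductChart f χ z) z h3 h1).congr_of_eventuallyEq ?_
  filter_upwards [hs] with y hy
  have hy' : f y.1.1 ∈ χ.U := hy
  have h4 := χ.sec_coord _ (y.2 ▸ hy' : π y.1.2 ∈ χ.U)
  rw [← y.2] at h4
  exact h4.symm

variable {E : Type*} [NormedAddCommGroup E] [NormedSpace ℂ E] {H : Type*} [TopologicalSpace H]
  {J : ModelWithCorners ℂ E H} {T : Type*} [TopologicalSpace T] [ChartedSpace H T]

/-- A map to a pullback is holomorphic if its two components are. -/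
lemma contMDiffAt_pullback_mk {k : T → h.pullback f} {t : T}
    (h1 : ContMDiffAt J S.I ω (fun t => (k t).1.1) t)
    (h2 : ContMDiffAt J P.I ω (fun t => (k t).1.2) t) :
    ContMDiffAt J (h.pullback f).I ω k t := by
  set χ := h.chartAtPoint f (k t)
  have ht : f (k t).1.1 ∈ χ.U := h.mem_chartAtPoint f (k t)
  have hp : π (k t).1.2 ∈ χ.U := (k t).2 ▸ ht
  have h3 : ContMDiffAt J G.I ω (fun t => χ.coord (k t).1.2) t :=
    (χ.contMDiffOn_coord.contMDiffAt ((χ.isOpen_U.preimage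
      h.holomorphic_proj.continuous).mem_nhds hp)).comp t h2
  have h4 : ContMDiffAt J (S.prod G).I ω
      (fun t => AnMfd.pair (k t).1.1 (χ.coord (k t).1.2)) t :=
    AnMfd.contMDiffWithinAt_toProd_iff.2 (h1.prodMk h3)
  have h5 := (h.contMDiffOn_pullbackChart_symm f (k t)).contMDiffAt
    (x := AnMfd.pair (k t).1.1 (χ.coord (k t).1.2))
    ((h.fibreProductChart f χ (k t)).open_target.mem_nhds ht)
  refine (ContMDiffAt.comp (f := fun t => AnMfd.pair (k t).1.1 (χ.coord (k t).1.2)) t h5 h4).congr_of_eventuallyEq ?_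
  -- Membership in the source of the chart is a condition on the first component only, so continuity
  -- of that component keeps `k` inside the chart.
  have hc : ContinuousAt (fun t => f (k t).1.1) t :=
    (AnMfd.hom_contMDiff f).continuous.continuousAt.comp h1.continuousAt
  filter_upwards [hc.eventually (χ.isOpen_U.mem_nhds ht)] with y hy
  exact ((h.fibreProductChart f χ (k t)).left_inv hy).symm

/-- The action of the structure group on a pullback. -/
@[reducible]
noncomputable def mulActionPullback : MulAction Gᵐᵒᵖ (h.pullback f) where
  smul g z := ⟨(z.1.1, g • z.1.2), z.2.trans (h.proj_act z.1.2 g.unop).symm⟩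
  one_smul z := Subtype.ext (Prod.ext rfl (one_smul _ z.1.2))
  mul_smul g g' z := Subtype.ext (Prod.ext rfl (mul_smul g g' z.1.2))

/-- The local section is `t ↦ (t, sec (f t))`, and the fibre coordinate is that of the second
component. -/
theorem pullback_isPrincipalBundle :
    let _ := h.mulActionPullback f
    IsPrincipalBundle G (P := h.pullback f) (fun z : h.pullback f => z.1.1) := by
  let _ := h.mulActionPullback f
  refine of_charts (fun q => ?_) (h.contMDiff_pullback_fst f) (fun _ _ => rfl) (fun s => ?_)
  · refine h.contMDiffAt_pullback_mk f ?_ ?_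
    · exact ((h.contMDiff_pullback_fst f).comp contMDiff_fst) q
    · exact (h.holomorphic_action.comp
        (((h.contMDiff_pullback_snd f).comp contMDiff_fst).prodMk contMDiff_snd)) q
  · classical
    obtain ⟨χ, hs⟩ := h.exists_chart (f s)
    have hopen : IsOpen {t | f t ∈ χ.U} :=
      χ.isOpen_U.preimage (AnMfd.hom_contMDiff f).continuous
    have hmem : ∀ t, f t ∈ χ.U → f t = π (χ.sec (f t)) := fun t ht => (χ.proj_sec _ ht).symm
    let σ : S → h.pullback f := fun t =>
      if ht : f t ∈ χ.U then ⟨(t, χ.sec (f t)), hmem t ht⟩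
      else ⟨(s, χ.sec (f s)), hmem s hs⟩
    have hσ : ∀ t (ht : f t ∈ χ.U), σ t = ⟨(t, χ.sec (f t)), hmem t ht⟩ :=
      fun t ht => dif_pos ht
    refine ⟨⟨{t | f t ∈ χ.U}, hopen, σ, fun z => χ.coord z.1.2, ?_, ?_, ?_, ?_, ?_, ?_⟩, hs⟩
    · intro t ht
      refine (h.contMDiffAt_pullback_mk f ?_ ?_).contMDiffWithinAt
      · refine contMDiffAt_id.congr_of_eventuallyEq ?_
        filter_upwards [hopen.mem_nhds ht] with y hy
        rw [hσ y hy, id]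
      · have h1 : ContMDiffAt S.I P.I ω (fun t => χ.sec (f t)) t :=
          (χ.contMDiffOn_sec.contMDiffAt (χ.isOpen_U.mem_nhds ht)).comp t
            (AnMfd.hom_contMDiff f t)
        refine h1.congr_of_eventuallyEq ?_
        filter_upwards [hopen.mem_nhds ht] with y hy
        rw [hσ y hy]
    · exact χ.contMDiffOn_coord.comp (h.contMDiff_pullback_snd f).contMDiffOn
        (fun z hz => (z.2 ▸ hz : π z.1.2 ∈ χ.U))
    · intro t ht
      rw [hσ t ht]
    · intro t ht
      rw [hσ t ht]
      exact χ.coord_sec _ ht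
    · exact fun z g hz => χ.coord_act _ g (z.2 ▸ hz : π z.1.2 ∈ χ.U)
    · intro z hz
      rw [hσ _ hz]
      refine Subtype.ext (Prod.ext rfl ?_)
      have h4 := χ.sec_coord _ (z.2 ▸ hz : π z.1.2 ∈ χ.U)
      rw [← z.2] at h4
      exact h4

end IsPrincipalBundle

/-! ### A principal bundle `X → M` makes `M` a fine moduli space -/

namespace OrbitFamily

variable {X G : AnMfd.{u}} [Group G] [MulAction Gᵐᵒᵖ X]

lemma Hom.proj_onTotal {Q P : OrbitFamily X G} (a : Hom Q P) (q : Q.total) :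
    P.proj (a.onTotal q) = a.onBase (Q.proj q) :=
  congrArg (fun φ : Q.total ⟶ P.base => φ q) a.comm_proj

lemma Hom.toX_onTotal {Q P : OrbitFamily X G} (a : Hom Q P) (q : Q.total) :
    P.toX (a.onTotal q) = Q.toX q :=
  congrArg (fun φ : Q.total ⟶ X => φ q) a.comm_toX

section IsIso

variable [LieGroup G.I ω G]

/-- A morphism of principal bundles over an isomorphism of the bases is an isomorphism. -/
theorem isIso_of_isIso_onBase {Q P : OrbitFamily X G} (a : Q ⟶ P)
    [hb : IsIso (Hom.onBase a)] : IsIso a := by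
  let a' : Hom Q P := a
  obtain ⟨b, hb1, hb2⟩ := hb
  have ba : ∀ s, b (a'.onBase s) = s := fun s => congrArg (fun φ : Q.base ⟶ Q.base => φ s) hb1
  have ab : ∀ s, a'.onBase (b s) = s := fun s => congrArg (fun φ : P.base ⟶ P.base => φ s) hb2
  -- Injectivity comes from freeness on `P`, surjectivity from transitivity on its fibres;
  -- holomorphy of the inverse is checked locally.
  have inj : Function.Injective a'.onTotal := fun q q' hq => by
    have h1 : Q.proj q = Q.proj q' := by
      rw [← ba (Q.proj q), ← ba (Q.proj q'), ← a'.proj_onTotal, ← a'.proj_onTotal]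
      exact congrArg (fun p => b (P.proj p)) hq
    obtain ⟨g, hg⟩ := Q.isPrincipalBundle.exists_act_eq h1
    have h2 : a'.onTotal q <• g = a'.onTotal q :=
      (a'.onTotal_act q g).symm.trans ((congrArg a'.onTotal hg).trans hq.symm)
    have h3 := P.isPrincipalBundle.isFreeAction _ g h2
    rw [← hg, h3, right_act_one]
  have surj : Function.Surjective a'.onTotal := fun p => by
    obtain ⟨q, hq⟩ := Q.isPrincipalBundle.surjective (b (P.proj p))
    have h1 : P.proj (a'.onTotal q) = P.proj p :=
      (a'.proj_onTotal q).trans ((congrArg a'.onBase hq).trans (ab _))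
    obtain ⟨g, hg⟩ := P.isPrincipalBundle.exists_act_eq h1
    exact ⟨q <• g, (a'.onTotal_act q g).trans hg⟩
  choose r hr using surj
  have rl : ∀ q, r (a'.onTotal q) = q := fun q => inj (hr _)
  have hol : ContMDiff P.total.I Q.total.I ω r := by
    intro p
    obtain ⟨χ, hχ⟩ := Q.isPrincipalBundle.exists_chart (b (P.proj p))
    obtain ⟨ξ, hξ⟩ := P.isPrincipalBundle.exists_chart (P.proj p)
    have hbP : ContMDiff P.total.I Q.base.I ω (fun p => b (P.proj p)) :=
      (AnMfd.hom_contMDiff b).comp (AnMfd.hom_contMDiff P.proj)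
    have hsec : ContMDiffAt P.total.I Q.total.I ω (fun p => χ.sec (b (P.proj p))) p :=
      (χ.contMDiffOn_sec.contMDiffAt (χ.isOpen_U.mem_nhds hχ)).comp p (hbP p)
    have hpU : IsOpen (P.proj ⁻¹' ξ.U) :=
      ξ.isOpen_U.preimage (AnMfd.hom_contMDiff P.proj).continuous
    have hproj : ∀ p', b (P.proj p') ∈ χ.U →
        P.proj (a'.onTotal (χ.sec (b (P.proj p')))) = P.proj p' := fun p' hp' =>
      (a'.proj_onTotal _).trans ((congrArg a'.onBase (χ.proj_sec _ hp')).trans (ab _))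
    have hcsec : ContMDiffAt P.total.I G.I ω
        (fun p => ξ.coord (a'.onTotal (χ.sec (b (P.proj p))))) p := by
      refine ContMDiffAt.comp (g := ξ.coord) p (ξ.contMDiffOn_coord.contMDiffAt (hpU.mem_nhds ?_))
        ((AnMfd.hom_contMDiff a'.onTotal _).comp p hsec)
      exact Set.mem_preimage.2 ((hproj p hχ).symm ▸ hξ)
    have hc : ContMDiffAt P.total.I G.I ω ξ.coord p :=
      ξ.contMDiffOn_coord.contMDiffAt (hpU.mem_nhds hξ)
    -- The group element carries the image of `χ.sec (b (P.proj p))` to `p` in `P`. By equivariance,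
    -- it carries `χ.sec (b (P.proj p))` to the preimage of `p` in `Q`.
    have hmain : ContMDiffAt P.total.I Q.total.I ω (fun p => χ.sec (b (P.proj p)) <•
        ((ξ.coord (a'.onTotal (χ.sec (b (P.proj p)))))⁻¹ * ξ.coord p)) p :=
      ContMDiffAt.comp (g := fun q : Q.total × G => q.1 <• q.2) p
        (Q.isPrincipalBundle.holomorphic_action _) (hsec.prodMk (hcsec.inv.mul hc))
    refine hmain.congr_of_eventuallyEq ?_
    filter_upwards [hbP.continuous.continuousAt.eventually (χ.isOpen_U.mem_nhds hχ),
      hpU.mem_nhds hξ] with p' h1 h2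
    refine inj ((hr p').trans ?_)
    have h3 := hproj p' h1
    exact ((a'.onTotal_act _ _).trans (ξ.act_inv_coord_mul (h3.symm ▸ h2) h3)).symm
  have r_act : ∀ (p : P.total) (g : G), r (p <• g) = r p <• g := fun p g =>
    inj ((hr _).trans ((congrArg (fun x => x <• g) (hr p)).symm.trans (a'.onTotal_act _ g).symm))
  let c : Hom P Q := ⟨b, ⟨r, hol⟩, r_act,
    AnMfd.hom_ext fun p => (ba _).symm.trans
      (congrArg b ((a'.proj_onTotal (r p)).symm.trans (congrArg P.proj (hr p)))),
    AnMfd.hom_ext fun p => (a'.toX_onTotal (r p)).symm.trans (congrArg P.toX (hr p))⟩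
  exact ⟨c, Hom.ext hb1 (AnMfd.hom_ext rl), Hom.ext hb2 (AnMfd.hom_ext hr)⟩

end IsIso

section Representability

variable {M : AnMfd.{u}} {π : X → M}

lemma exists_classify (h : IsPrincipalBundle G π) (Q : OrbitFamily X G) :
    ∃ k : Q.base ⟶ M, ∀ q, k (Q.proj q) = π (Q.toX q) := by
  let p : X ⟶ M := ⟨π, h.holomorphic_proj⟩
  refine Q.isPrincipalBundle.exists_descent (Q.toX ≫ p) fun q g => ?_
  exact (congrArg π (Q.toX_act q g)).trans (h.proj_act _ g)

variable (h : IsPrincipalBundle G π)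

/-- The map to the base of a principal bundle `X → M` that a family of orbits determines. -/
noncomputable def classify (Q : OrbitFamily X G) : Q.base ⟶ M := (exists_classify h Q).choose

lemma classify_proj (Q : OrbitFamily X G) (q : Q.total) :
    classify h Q (Q.proj q) = π (Q.toX q) :=
  (exists_classify h Q).choose_spec q

lemma classify_unique (Q : OrbitFamily X G) {k : Q.base ⟶ M}
    (hk : ∀ q, k (Q.proj q) = π (Q.toX q)) : k = classify h Q :=
  AnMfd.hom_ext fun s => by
    obtain ⟨q, rfl⟩ := Q.isPrincipalBundle.surjective s
    exact (hk q).trans (classify_proj h Q q).symm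

lemma onBase_classify {Q P : OrbitFamily X G} (a : Hom Q P) :
    CategoryStruct.comp a.onBase (classify h P) = classify h Q :=
  classify_unique h Q fun q =>
    (congrArg (classify h P) (a.proj_onTotal q).symm).trans
      ((classify_proj h P _).trans (congrArg π (a.toX_onTotal q)))

/-- The functor from families of orbits to manifolds over `M`. -/
noncomputable def classifyFunctor : OrbitFamily X G ⥤ Over M where
  obj Q := Over.mk (classify h Q)
  map a := Over.homMk (Hom.onBase a) (onBase_classify h a)
  map_id _ := rfl
  map_comp _ _ := rfl

/-- The family of orbits attached to a map to the base of a principal bundle `X → M`. -/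
noncomputable def ofPullback {S : AnMfd.{u}} (f : S ⟶ M) : OrbitFamily X G :=
  letI := h.mulActionPullback f
  { base := S
    total := h.pullback f
    proj := ⟨_, h.contMDiff_pullback_fst f⟩
    isPrincipalBundle := h.pullback_isPrincipalBundle f
    toX := ⟨_, h.contMDiff_pullback_snd f⟩
    toX_act := fun _ _ => rfl }

lemma classify_ofPullback {S : AnMfd.{u}} (f : S ⟶ M) : f = classify h (ofPullback h f) :=
  classify_unique h (ofPullback h f) fun q => q.2

/-- The morphism between pullbacks that a map over `M` induces. -/
noncomputable def ofPullbackMap {S T : AnMfd.{u}} {f : S ⟶ M} {f' : T ⟶ M} (k : S ⟶ T)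
    (hk : k ≫ f' = f) : Hom (ofPullback h f) (ofPullback h f') where
  onBase := k
  onTotal := ⟨fun z => ⟨(k z.1.1, z.1.2),
      (congrArg (fun φ : S ⟶ M => φ z.1.1) hk).trans z.2⟩, fun z =>
    h.contMDiffAt_pullback_mk f' ((AnMfd.hom_contMDiff k _).comp z (h.contMDiff_pullback_fst f z))
      (h.contMDiff_pullback_snd f z)⟩
  onTotal_act _ _ := rfl
  comm_proj := rfl
  comm_toX := rfl

/-- The functor from manifolds over `M` to families of orbits, given by pullback. -/
noncomputable def pullbackFunctor : Over M ⥤ OrbitFamily X G where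
  obj f := ofPullback h f.hom
  map φ := ofPullbackMap h φ.left (Over.w φ)
  map_id _ := rfl
  map_comp _ _ := rfl

/-- The comparison of a family of orbits with a pullback. -/
noncomputable def toPullback (Q : OrbitFamily X G) : Q ⟶ ofPullback h (classify h Q) where
  onBase := 𝟙 _
  onTotal := ⟨fun q => ⟨(Q.proj q, Q.toX q), classify_proj h Q q⟩, fun q =>
    h.contMDiffAt_pullback_mk _ (AnMfd.hom_contMDiff Q.proj q) (AnMfd.hom_contMDiff Q.toX q)⟩
  onTotal_act q g := Subtype.ext (Prod.ext (Q.isPrincipalBundle.proj_act q g) (Q.toX_act q g))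
  comm_proj := rfl
  comm_toX := rfl

/-- The projection of the pullback along the identity to the bundle itself. -/
noncomputable def ofPullbackId : ofPullback h (𝟙 M) ⟶ ofTotalX X G h where
  onBase := 𝟙 M
  onTotal := ⟨_, h.contMDiff_pullback_snd (𝟙 M)⟩
  onTotal_act _ _ := rfl
  comm_proj := AnMfd.hom_ext fun z => z.2.symm
  comm_toX := rfl

variable [LieGroup G.I ω G]

lemma isIso_toPullback (Q : OrbitFamily X G) : IsIso (toPullback h Q) :=
  have : IsIso (Hom.onBase (toPullback h Q)) := inferInstanceAs (IsIso (𝟙 Q.base))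
  isIso_of_isIso_onBase _

/-- The unit of the equivalence between `[X/G]` and the stack of the base of a principal bundle
`X → M`. -/
noncomputable def unitIso : 𝟭 (OrbitFamily X G) ≅ classifyFunctor h ⋙ pullbackFunctor h :=
  NatIso.ofComponents
    (fun Q => @asIso _ _ _ _ (toPullback h Q) (isIso_toPullback h Q))
    (fun a => Hom.ext ((Category.comp_id (Hom.onBase a)).trans
      (Category.id_comp (Hom.onBase a)).symm) (AnMfd.hom_ext fun q => Subtype.ext (Prod.ext
      (Hom.proj_onTotal a q) (Hom.toX_onTotal a q))))

/-- The counit of the equivalence between `[X/G]` and the stack of the base of a principal bundle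
`X → M`. -/
noncomputable def counitIso : pullbackFunctor h ⋙ classifyFunctor h ≅ 𝟭 (Over M) :=
  NatIso.ofComponents (fun f => Over.isoMk (Iso.refl f.left)
    ((Category.id_comp _).trans (classify_ofPullback h f.hom)))
    (fun {f f'} φ => by
      apply Over.OverMorphism.ext
      exact (Category.comp_id φ.left).trans (Category.id_comp φ.left).symm)

/-- The functor from `[X/G]` to the stack of the base of a principal bundle `X → M`. -/
noncomputable def classifyBased : BasedFunctor (quotientStack X G) M.stack where
  toFunctor := classifyFunctor h
  w := rfl

/-- The functor from the stack of the base of a principal bundle `X → M` to `[X/G]`. -/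
noncomputable def pullbackBased : BasedFunctor M.stack (quotientStack X G) where
  toFunctor := pullbackFunctor h
  w := rfl

/-- The base of a principal bundle with total space `X` represents the quotient stack. -/
noncomputable def stackEquivalence : Bicategory.Equivalence (quotientStack X G) M.stack :=
  -- This constructor corrects the counit so that the triangle identity holds. The inverse functor
  -- remains `pullbackBased h`.
  Bicategory.Equivalence.mkOfAdjointifyCounit (a := quotientStack X G) (b := M.stack)
    (f := classifyBased h) (g := pullbackBased h)
    (BasedNatIso.mkNatIso (F := BasedFunctor.id (quotientStack X G))
      (G := BasedFunctor.comp (classifyBased h) (pullbackBased h)) (unitIso h) fun Q =>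
      IsHomLift.map (toBase X G) (toPullback h Q))
    (BasedNatIso.mkNatIso (F := BasedFunctor.comp (pullbackBased h) (classifyBased h))
      (G := BasedFunctor.id M.stack) (counitIso h) fun f =>
      IsHomLift.map (Over.forget M) ((counitIso h).hom.app f))

/-- The inverse functor sends `𝟙 M` to the pullback of `X` along the identity, whose projection to
`X` covers `𝟙 M` and is therefore invertible. -/
theorem exists_stackEquivalence : ∃ (e : Bicategory.Equivalence (quotientStack X G) M.stack)
    (φ : (BasedFunctor.toFunctor e.inv).obj (Over.mk (𝟙 M)) ≅ ofTotalX X G h),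
    (quotientStack X G).p.IsHomLift (𝟙 M) φ.hom := by
  have h1 : IsIso (Hom.onBase (ofPullbackId h)) := inferInstanceAs (IsIso (𝟙 M))
  have h2 : IsIso (ofPullbackId h) := isIso_of_isIso_onBase _
  let φ : ofPullback h (𝟙 M) ≅ ofTotalX X G h := asIso (ofPullbackId h)
  exact ⟨stackEquivalence h, φ,
    IsHomLift.map (toBase X G) (ofPullbackId h)⟩

end Representability

end OrbitFamily

/-! ### The orbit space: topology, and charts from slices -/

section OrbitSpaceTopology

variable {X G : AnMfd.{u}} [Group G] [MulAction Gᵐᵒᵖ X]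

lemma orbitProj_eq_iff {x y : X} : orbitProj X G x = orbitProj X G y ↔ ∃ g : G, y <• g = x := by
  rw [orbitProj, Quotient.eq, MulAction.orbitRel_apply]
  exact ⟨fun ⟨g, hg⟩ => ⟨g.unop, hg⟩, fun ⟨g, hg⟩ => ⟨MulOpposite.op g, hg⟩⟩

lemma orbitProj_act (x : X) (g : G) : orbitProj X G (x <• g) = orbitProj X G x :=
  orbitProj_eq_iff.2 ⟨g, rfl⟩

lemma exists_act_eq_out (x : X) : ∃ g : G, x <• g = Quotient.out (orbitProj X G x) :=
  orbitProj_eq_iff.1 (Quotient.out_eq (orbitProj X G x))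

lemma IsHolomorphicAction.contMDiff_act (hact : IsHolomorphicAction X G) (g : G) :
    ContMDiff X.I X.I ω (fun x : X => x <• g) :=
  hact.comp (contMDiff_id.prodMk contMDiff_const)

lemma isOpenQuotientMap_orbitProj (hact : IsHolomorphicAction X G) :
    IsOpenQuotientMap (orbitProj X G) :=
  have : ContinuousConstSMul Gᵐᵒᵖ X := ⟨fun g => (hact.contMDiff_act g.unop).continuous⟩
  MulAction.isOpenQuotientMap_quotientMk

lemma nhds_orbitProj (hact : IsHolomorphicAction X G) (x : X) :
    nhds (orbitProj X G x) = Filter.map (orbitProj X G) (nhds x) :=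
  ((isOpenQuotientMap_orbitProj hact).isOpenMap.map_nhds_eq
    (isOpenQuotientMap_orbitProj hact).continuous.continuousAt).symm

/-- The orbit relation is the range of a proper map, hence closed, and an open quotient by a closed
relation is Hausdorff. -/
lemma t2Space_orbitSpace (hact : IsHolomorphicAction X G) (hp : IsProperAction X G) :
    T2Space (OrbitSpace X G) := by
  rw [t2Space_iff_of_isOpenQuotientMap (isOpenQuotientMap_orbitProj hact)]
  convert hp.isClosed_range using 1
  ext ⟨x, y⟩
  constructor
  · intro h
    obtain ⟨g, hg⟩ := orbitProj_eq_iff.1 (show orbitProj X G y = orbitProj X G x from h.symm)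
    exact ⟨(x, g), Prod.ext rfl hg⟩
  · rintro ⟨⟨z, g⟩, hz⟩
    obtain ⟨rfl, rfl⟩ := Prod.ext_iff.1 hz
    exact (orbitProj_act _ _).symm

end OrbitSpaceTopology

/-- A slice for a free right action, given by a parametrisation `sec` of the slice by the open set
`W` of a vector space, the open union `O` of the orbits that meet the slice, and the two components
`slice` and `coord` of the inverse of `(w, g) ↦ sec w · g`. -/
structure LocalSlice (X G : AnMfd.{u}) [Group G] [MulAction Gᵐᵒᵖ X] (E : Type)
    [NormedAddCommGroup E] [NormedSpace ℂ E] where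
  /-- The parameter domain of the slice. -/
  W : Set E
  isOpen_W : IsOpen W
  /-- The union of the orbits that meet the slice. -/
  O : Set X
  isOpen_O : IsOpen O
  /-- The parametrisation of the slice. -/
  sec : E → X
  /-- The parameter of the orbit of a point. -/
  slice : X → E
  /-- The position of a point in its orbit. -/
  coord : X → G
  contMDiffOn_sec : ContMDiffOn 𝓘(ℂ, E) X.I ω sec W
  contMDiffOn_slice : ContMDiffOn X.I 𝓘(ℂ, E) ω slice O
  contMDiffOn_coord : ContMDiffOn X.I G.I ω coord O
  sec_mem : ∀ w ∈ W, sec w ∈ O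
  slice_mem : ∀ x ∈ O, slice x ∈ W
  act_mem : ∀ x (g : G), x ∈ O → x <• g ∈ O
  slice_act : ∀ x (g : G), x ∈ O → slice (x <• g) = slice x
  coord_act : ∀ x (g : G), x ∈ O → coord (x <• g) = coord x * g
  slice_sec : ∀ w ∈ W, slice (sec w) = w
  coord_sec : ∀ w ∈ W, coord (sec w) = 1
  sec_coord : ∀ x ∈ O, sec (slice x) <• coord x = x

namespace LocalSlice

variable {X G : AnMfd.{u}} [Group G] [MulAction Gᵐᵒᵖ X] {E : Type}
  [NormedAddCommGroup E] [NormedSpace ℂ E] (hact : IsHolomorphicAction X G)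

lemma mem_of_orbitProj_eq (s : LocalSlice X G E) {x y : X} (hx : x ∈ s.O)
    (h : orbitProj X G y = orbitProj X G x) : y ∈ s.O := by
  obtain ⟨g, rfl⟩ := orbitProj_eq_iff.1 h
  exact s.act_mem x g hx

/-- Since `slice` is constant on orbits, evaluating it at arbitrary representatives gives a
well-behaved function on the orbit space. -/
lemma slice_out (s : LocalSlice X G E) {x : X} (hx : x ∈ s.O) :
    s.slice (Quotient.out (orbitProj X G x)) = s.slice x := by
  obtain ⟨g, hg⟩ := exists_act_eq_out (G := G) x
  rw [← hg, s.slice_act x g hx]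

/-- The chart of the orbit space given by a slice. -/
noncomputable def chart (s : LocalSlice X G E) : OpenPartialHomeomorph (OrbitSpace X G) E where
  toFun q := s.slice (Quotient.out q)
  invFun w := orbitProj X G (s.sec w)
  source := orbitProj X G '' s.O
  target := s.W
  map_source' := by
    rintro _ ⟨x, hx, rfl⟩
    rw [s.slice_out hx]
    exact s.slice_mem x hx
  map_target' w hw := ⟨_, s.sec_mem w hw, rfl⟩
  left_inv' := by
    rintro _ ⟨x, hx, rfl⟩
    rw [s.slice_out hx]
    nth_rw 2 [← s.sec_coord x hx]
    rw [orbitProj_act]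
  right_inv' w hw := by
    rw [s.slice_out (s.sec_mem w hw), s.slice_sec w hw]
  open_source := (isOpenQuotientMap_orbitProj hact).isOpenMap _ s.isOpen_O
  open_target := s.isOpen_W
  continuousOn_toFun := by
    rintro _ ⟨x, hx, rfl⟩
    apply ContinuousAt.continuousWithinAt
    rw [ContinuousAt, nhds_orbitProj hact, Filter.tendsto_map'_iff, s.slice_out hx]
    have h := s.contMDiffOn_slice.continuousOn.continuousAt (s.isOpen_O.mem_nhds hx)
    refine h.tendsto.congr' ?_
    filter_upwards [s.isOpen_O.mem_nhds hx] with y hy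
    exact (s.slice_out hy).symm
  continuousOn_invFun :=
    (isOpenQuotientMap_orbitProj hact).continuous.comp_continuousOn s.contMDiffOn_sec.continuousOn

/-- The transition map is `t.slice ∘ s.sec`. -/
lemma contMDiffOn_transition (s t : LocalSlice X G E) :
    ContMDiffOn 𝓘(ℂ, E) 𝓘(ℂ, E) ω (t.chart hact ∘ (s.chart hact).symm)
      ((s.chart hact).symm ≫ₕ t.chart hact).source := by
  have h : ∀ w ∈ ((s.chart hact).symm ≫ₕ t.chart hact).source, w ∈ s.W ∧ s.sec w ∈ t.O := by
    intro w hw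
    rw [OpenPartialHomeomorph.trans_source] at hw
    obtain ⟨hw1, x, hx, hxw⟩ := hw
    exact ⟨hw1, t.mem_of_orbitProj_eq hx hxw.symm⟩
  refine (ContMDiffOn.comp (g := t.slice) t.contMDiffOn_slice
    (s.contMDiffOn_sec.mono fun w hw => (h w hw).1) (fun w hw => (h w hw).2)).congr ?_
  exact fun w hw => t.slice_out (h w hw).2

end LocalSlice

/-- If there are slices through all points, then the orbit space is a complex analytic manifold and
`X` is a principal bundle over it. -/
theorem exists_isPrincipalBundle_of_localSlice {X G : AnMfd.{u}} [Group G] [MulAction Gᵐᵒᵖ X]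
    (hact : IsHolomorphicAction X G) [T2Space (OrbitSpace X G)] {E : Type} [NormedAddCommGroup E]
    [NormedSpace ℂ E] [FiniteDimensional ℂ E]
    (hs : ∀ x : X, ∃ s : LocalSlice X G E, x ∈ s.O) :
    ∃ (_ : ChartedSpace E (OrbitSpace X G)) (_ : IsManifold 𝓘(ℂ, E) ω (OrbitSpace X G)),
      IsPrincipalBundle G (P := X) (S := AnMfd.of E (OrbitSpace X G)) (orbitProj X G) := by
  choose s hs using hs
  obtain ⟨cs, man, h⟩ := exists_isManifold_of_openPartialHomeomorph
    (fun q : OrbitSpace X G => (s (Quotient.out q)).chart hact)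
    (fun q => ⟨_, hs _, Quotient.out_eq q⟩)
    (fun q r => (s _).contMDiffOn_transition hact (s _))
  refine ⟨cs, man, IsPrincipalBundle.of_charts hact (fun x => ?_) orbitProj_act (fun q => ?_)⟩
  · set t := s (Quotient.out (orbitProj X G x)) with ht
    have hx : x ∈ t.O :=
      t.mem_of_orbitProj_eq (hs _) (Quotient.out_eq (orbitProj X G x)).symm
    have h1 := t.contMDiffOn_slice.contMDiffAt (t.isOpen_O.mem_nhds hx)
    have h2 := ((h (orbitProj X G x)).2).contMDiffAt
      (((s (Quotient.out (orbitProj X G x))).chart hact).open_target.mem_nhds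
        (t.slice_mem x hx))
    -- Near `x` the projection is `slice` followed by the inverse chart, because `y` and `sec (slice
    -- y)` share an orbit.
    refine (ContMDiffAt.comp (g := (t.chart hact).symm) x h2 h1).congr_of_eventuallyEq ?_
    filter_upwards [t.isOpen_O.mem_nhds hx] with y hy
    have h3 := orbitProj_act (t.sec (t.slice y)) (t.coord y)
    rw [t.sec_coord y hy] at h3
    exact h3
  · set t := s (Quotient.out q) with ht
    have hπ : ∀ x, orbitProj X G x ∈ orbitProj X G '' t.O → x ∈ t.O := by
      rintro x ⟨y, hy, hxy⟩
      exact t.mem_of_orbitProj_eq hy hxy.symm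
    have hO : orbitProj X G ⁻¹' (orbitProj X G '' t.O) ⊆ t.O := hπ
    refine ⟨⟨orbitProj X G '' t.O, (t.chart hact).open_source,
      fun q => t.sec (t.slice (Quotient.out q)), t.coord, ?_, t.contMDiffOn_coord.mono hO,
      ?_, ?_, ?_, ?_⟩, ⟨_, hs _, Quotient.out_eq q⟩⟩
    · exact t.contMDiffOn_sec.comp (h q).1 fun r hr => (t.chart hact).map_source hr
    · exact fun r hr => (t.chart hact).left_inv hr
    · rintro _ ⟨x, hx, rfl⟩
      rw [t.slice_out hx]
      exact t.coord_sec _ (t.slice_mem x hx)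
    · exact fun x g hx => t.coord_act x g (hπ x hx)
    · intro x hx
      rw [t.slice_out (hπ x hx)]
      exact t.sec_coord x (hπ x hx)

/-! ### Orbit maps of free actions are immersions -/

section Analysis

open Filter Topology

/-- A vector field in the kernel of the derivative of a locally injective map vanishes. -/
theorem eq_zero_of_hasFDerivAt_apply_eq_zero {E F : Type*} [NormedAddCommGroup E] [NormedSpace ℂ E]
    [CompleteSpace E] [NormedAddCommGroup F] [NormedSpace ℂ F] {f : E → F} {v : E → E} {x₀ : E}
    (hv : ContDiffAt ℂ 1 v x₀) {s : Set E} (hs : s ∈ 𝓝 x₀) (hinj : Set.InjOn f s)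
    (hf : ∀ᶠ x in 𝓝 x₀, ∃ f' : E →L[ℂ] F, HasFDerivAt f f' x ∧ f' (v x) = 0) : v x₀ = 0 := by
  -- Take a real-time integral curve of `v` through `x₀`. Along it `f` has derivative zero, so local
  -- injectivity makes the curve constant near time zero, and its velocity `v x₀` vanishes.
  obtain ⟨γ, h0, ε, hε, hγ⟩ :=
    (hv.restrict_scalars ℝ).exists_forall_mem_closedBall_exists_eq_forall_mem_Ioo_hasDerivAt₀ 0
  have hγ0 : HasDerivAt γ (v x₀) 0 := by
    have := hγ 0 ⟨by linarith, by linarith⟩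
    rwa [h0] at this
  have hev : ∀ᶠ t in 𝓝 (0 : ℝ), γ t ∈ s ∧ HasDerivAt (fun t => f (γ t)) 0 t := by
    have hc : Tendsto γ (𝓝 0) (𝓝 x₀) := h0 ▸ hγ0.continuousAt.tendsto
    filter_upwards [hc.eventually hs, hc.eventually hf,
      Ioo_mem_nhds (show (0 : ℝ) - ε < 0 by linarith) (show (0 : ℝ) < 0 + ε by linarith)]
      with t h1 ⟨f', h2, h3⟩ h4
    refine ⟨h1, ?_⟩
    have := (h2.restrictScalars ℝ).comp_hasDerivAt t (hγ t h4)
    rw [ContinuousLinearMap.coe_restrictScalars', h3] at this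
    exact this
  obtain ⟨δ, hδ, hball⟩ := Metric.eventually_nhds_iff_ball.1 hev
  have hconst : ∀ t ∈ Metric.ball (0 : ℝ) δ, γ t = x₀ := fun t ht => by
    have h1 : f (γ t) = f (γ 0) :=
      Metric.isOpen_ball.is_const_of_deriv_eq_zero (convex_ball (0 : ℝ) δ).isPreconnected
        (f := fun t => f (γ t)) (fun z hz => (hball z hz).2.differentiableAt.differentiableWithinAt)
        (fun z hz => (hball z hz).2.deriv) ht (Metric.mem_ball_self hδ)
    rw [← h0]
    exact hinj (hball t ht).1 (hball 0 (Metric.mem_ball_self hδ)).1 h1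
  have h2 : HasDerivAt γ 0 0 := (hasDerivAt_const (0 : ℝ) x₀).congr_of_eventuallyEq <| by
    filter_upwards [Metric.ball_mem_nhds (0 : ℝ) hδ] with t ht using hconst t ht
  exact hγ0.unique h2

/-- Local coordinates of a manifold that are centred at a point. -/
structure CentredCoord (M : AnMfd.{u}) (p : M) where
  /-- The coordinates. -/
  coord : M → M.Model
  /-- The point with given coordinates. -/
  point : M.Model → M
  coord_self : coord p = 0
  point_zero : point 0 = p
  contMDiffAt_coord : ContMDiffAt M.I 𝓘(ℂ, M.Model) ω coord p
  contMDiffAt_point : ContMDiffAt 𝓘(ℂ, M.Model) M.I ω point 0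
  point_coord : ∀ᶠ y in 𝓝 p, point (coord y) = y
  coord_point : ∀ᶠ z in 𝓝 0, coord (point z) = z

lemma AnMfd.nonempty_centredCoord (M : AnMfd.{u}) (p : M) : Nonempty (CentredCoord M p) := by
  set φ := extChartAt M.I p with hφ
  have hc : Tendsto (fun z : M.Model => z + φ p) (𝓝 0) (𝓝 (φ p)) := by
    have : Continuous (fun z : M.Model => z + φ p) := by fun_prop
    simpa using this.tendsto 0
  have hs : ContMDiffAt 𝓘(ℂ, M.Model) M.I ω φ.symm (φ p) :=
    (contMDiffOn_extChartAt_symm p).contMDiffAt (extChartAt_target_mem_nhds p)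
  refine ⟨⟨fun y => φ y - φ p, fun z => φ.symm (z + φ p), sub_self _, ?_, ?_, ?_, ?_, ?_⟩⟩
  · rw [zero_add, extChartAt_to_inv]
  · exact ContMDiffAt.sub contMDiffAt_extChartAt contMDiffAt_const
  · refine ContMDiffAt.comp (g := φ.symm) 0 ?_ (contMDiffAt_id.add contMDiffAt_const)
    simpa using hs
  · filter_upwards [extChartAt_source_mem_nhds (I := M.I) p] with y hy
    rw [sub_add_cancel]
    exact φ.left_inv hy
  · filter_upwards [hc.eventually (extChartAt_target_mem_nhds (I := M.I) p)] with z hz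
    rw [φ.right_inv hz, add_sub_cancel_right]

lemma ContMDiffAt.act {G Y : AnMfd.{u}} [Group G] [MulAction Gᵐᵒᵖ Y]
    (hact : IsHolomorphicAction Y G) {E : Type*} [NormedAddCommGroup E] [NormedSpace ℂ E]
    {H : Type*} [TopologicalSpace H] {J : ModelWithCorners ℂ E H} {T : Type*} [TopologicalSpace T]
    [ChartedSpace H T] {k : T → Y} {l : T → G} {t : T} (hk : ContMDiffAt J Y.I ω k t)
    (hl : ContMDiffAt J G.I ω l t) : ContMDiffAt J Y.I ω (fun t => k t <• l t) t :=
  ContMDiffAt.comp (g := fun q : Y × G => q.1 <• q.2) t (hact _) (hk.prodMk hl)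

variable {G X : AnMfd.{u}} [Group G] [LieGroup G.I ω G] [MulAction Gᵐᵒᵖ X]

/-- The orbit map of a free action is an immersion at the identity. -/
theorem fderiv_orbit_injective (hact : IsHolomorphicAction X G) (hfree : IsFreeAction X G) {x : X}
    (φ : CentredCoord G 1) (ψ : CentredCoord X x) :
    DifferentiableAt ℂ (fun b => ψ.coord (x <• φ.point b)) 0 ∧
    Function.Injective (fderiv ℂ (fun b => ψ.coord (x <• φ.point b)) 0) := by
  set F : G.Model → X.Model := fun b => ψ.coord (x <• φ.point b) with hF
  have hx1 : x <• φ.point 0 = x := by rw [φ.point_zero, right_act_one]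
  have horb : ContMDiffAt 𝓘(ℂ, G.Model) X.I ω (fun b => x <• φ.point b) 0 :=
    contMDiffAt_const.act hact φ.contMDiffAt_point
  have horbc : Tendsto (fun b => x <• φ.point b) (𝓝 0) (𝓝 x) := by
    simpa only [hx1] using horb.continuousAt.tendsto
  have hFc : ContDiffAt ℂ ω F 0 := by
    rw [← contMDiffAt_iff_contDiffAt]
    refine ContMDiffAt.comp (g := ψ.coord) 0 ?_ horb
    rw [hx1]
    exact ψ.contMDiffAt_coord
  have hFd : ∀ᶠ b in 𝓝 0, DifferentiableAt ℂ F b :=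
    (hFc.eventually (by simp)).mono fun b hb => hb.differentiableAt (by simp)
  refine ⟨hFd.self_of_nhds, ?_⟩
  rw [injective_iff_map_eq_zero]
  intro v hv
  have hφc : Tendsto φ.point (𝓝 0) (𝓝 1) := by
    simpa only [φ.point_zero] using φ.contMDiffAt_point.continuousAt.tendsto
  -- The product is `a * b` with `b` on the right, so that `x · (ab) = (x · a) · b` lets the kernel
  -- at the identity spread to nearby points.
  let m : G.Model → G.Model → G.Model := fun b a => φ.coord (φ.point a * φ.point b)
  have hmul : ContMDiffAt 𝓘(ℂ, G.Model × G.Model) G.I ω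
      (fun q : G.Model × G.Model => φ.point q.2 * φ.point q.1) (0, 0) :=
    ContMDiffAt.mul
      (ContMDiffAt.comp (g := φ.point) (0, 0) φ.contMDiffAt_point contDiff_snd.contMDiff.contMDiffAt)
      (ContMDiffAt.comp (g := φ.point) (0, 0) φ.contMDiffAt_point contDiff_fst.contMDiff.contMDiffAt)
  have hmulc : Tendsto (fun q : G.Model × G.Model => φ.point q.2 * φ.point q.1) (𝓝 (0, 0))
      (𝓝 1) := by
    have := hmul.continuousAt.tendsto
    simpa only [φ.point_zero, one_mul] using this
  have hm : ContDiffAt ℂ ω (Function.uncurry m) (0, 0) := by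
    rw [← contMDiffAt_iff_contDiffAt]
    refine ContMDiffAt.comp (g := φ.coord) (0, 0) ?_ hmul
    simp only [φ.point_zero, one_mul]
    exact φ.contMDiffAt_coord
  -- The right-invariant vector field that extends `v`, in coordinates. It will be shown to lie in
  -- the kernel of the derivative of the locally injective map `F`.
  let w : G.Model → G.Model := fun b => fderiv ℂ (m b) 0 v
  have hw : ContDiffAt ℂ 1 w 0 :=
    (ContDiffAt.fderiv (n := ω) hm contDiffAt_const le_top).clm_apply contDiffAt_const
  have hm0 : ∀ᶠ a in 𝓝 0, m 0 a = a := by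
    filter_upwards [φ.coord_point] with a ha
    simp only [m, φ.point_zero, mul_one, ha]
  have hw0 : w 0 = v := by
    have : HasFDerivAt (m 0) (ContinuousLinearMap.id ℂ G.Model) 0 :=
      (hasFDerivAt_id 0).congr_of_eventuallyEq hm0
    simp only [w, this.fderiv, ContinuousLinearMap.id_apply]
  rw [← hw0]
  refine eq_zero_of_hasFDerivAt_apply_eq_zero (f := F) hw
    (s := {b | φ.coord (φ.point b) = b ∧ ψ.point (ψ.coord (x <• φ.point b)) = x <• φ.point b})
    (φ.coord_point.and (horbc.eventually ψ.point_coord)) ?_ ?_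
  · rintro a ⟨ha1, ha2⟩ b ⟨hb1, hb2⟩ hab
    have h1 : x <• φ.point a = x <• φ.point b := by
      rw [← ha2, ← hb2]
      exact congrArg ψ.point hab
    have h2 : φ.point a * (φ.point b)⁻¹ = 1 := hfree x _ <| by
      rw [right_act_mul, h1, ← right_act_mul, mul_inv_cancel, right_act_one]
    rw [← ha1, ← hb1, mul_inv_eq_one.1 h2]
  · let R : X.Model × G.Model → X.Model := fun q => ψ.coord (ψ.point q.1 <• φ.point q.2)
    have hR : ContDiffAt ℂ ω R (0, 0) := by
      rw [← contMDiffAt_iff_contDiffAt]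
      refine ContMDiffAt.comp (g := ψ.coord) (0, 0) ?_ (ContMDiffAt.act hact
        (ContMDiffAt.comp (g := ψ.point) (0, 0) ψ.contMDiffAt_point
          contDiff_fst.contMDiff.contMDiffAt)
        (ContMDiffAt.comp (g := φ.point) (0, 0) φ.contMDiffAt_point
          contDiff_snd.contMDiff.contMDiffAt))
      simp only [φ.point_zero, ψ.point_zero, right_act_one]
      exact ψ.contMDiffAt_coord
    have hRd : ∀ᶠ b in 𝓝 0, DifferentiableAt ℂ (fun y => R (y, b)) 0 := by
      have hc : Tendsto (fun b : G.Model => ((0 : X.Model), b)) (𝓝 0) (𝓝 (0, 0)) :=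
        (Continuous.prodMk_right (0 : X.Model)).tendsto 0
      filter_upwards [hc.eventually (hR.eventually (by simp))] with b hb
      exact DifferentiableAt.comp (g := R) (0 : X.Model) (hb.differentiableAt (by simp))
        (differentiableAt_id.prodMk (differentiableAt_const b))
    have hmd : ∀ᶠ b in 𝓝 0, DifferentiableAt ℂ (m b) 0 := by
      have hc : Tendsto (fun b : G.Model => (b, (0 : G.Model))) (𝓝 0) (𝓝 (0, 0)) :=
        (Continuous.prodMk_left (0 : G.Model)).tendsto 0
      filter_upwards [hc.eventually (hm.eventually (by simp))] with b hb
      exact DifferentiableAt.comp (g := Function.uncurry m) (0 : G.Model)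
        (hb.differentiableAt (by simp)) ((differentiableAt_const b).prodMk differentiableAt_id)
    have hmb : ∀ᶠ b in 𝓝 0, m b 0 = b := by
      filter_upwards [φ.coord_point] with b hb
      simp only [m, φ.point_zero, one_mul, hb]
    -- Differentiating this relation in `a` at `0` along `v` gives `dF_b (w b)` on the left and,
    -- since `dF_0 v = 0`, zero on the right.
    have hrel : ∀ᶠ b in 𝓝 0, ∀ᶠ a in 𝓝 0, F (m b a) = R (F a, b) := by
      apply Filter.Eventually.curry_nhds (p := fun q : G.Model × G.Model =>
        F (m q.1 q.2) = R (F q.2, q.1))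
      have hc : Tendsto (fun q : G.Model × G.Model => q.2) (𝓝 (0, 0)) (𝓝 0) :=
        continuous_snd.tendsto _
      filter_upwards [hmulc.eventually φ.point_coord,
        (horbc.comp hc).eventually ψ.point_coord] with q h1 h2
      simp only [Function.comp_apply] at h2
      simp only [F, m, R, h1, h2, right_act_mul]
    filter_upwards [hFd, hRd, hmd, hmb, hrel] with b h1 h2 h3 h4 h5
    refine ⟨fderiv ℂ F b, h1.hasFDerivAt, ?_⟩
    have hF0 : F 0 = 0 := by simp only [F, hx1, ψ.coord_self]
    have hl : HasFDerivAt (fun a => F (m b a)) ((fderiv ℂ F b).comp (fderiv ℂ (m b) 0)) 0 := by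
      refine HasFDerivAt.comp (g := F) 0 ?_ h3.hasFDerivAt
      rw [h4]
      exact h1.hasFDerivAt
    have hr : HasFDerivAt (fun a => R (F a, b))
        ((fderiv ℂ (fun y => R (y, b)) 0).comp (fderiv ℂ F 0)) 0 := by
      refine HasFDerivAt.comp (g := fun y => R (y, b)) 0 ?_ hFd.self_of_nhds.hasFDerivAt
      rw [hF0]
      exact h2.hasFDerivAt
    have := congrArg (fun L : G.Model →L[ℂ] X.Model => L v)
      (hl.unique (hr.congr_of_eventuallyEq h5))
    simp only [ContinuousLinearMap.comp_apply, hv, map_zero] at this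
    exact this

end Analysis

/-! ### Existence of slices -/

section Slices

open Filter Topology

variable {G X : AnMfd.{u}} [Group G] [MulAction Gᵐᵒᵖ X]

/-- Freeness gives injectivity and properness gives closedness. What matters later is that the
topology is induced: if `y` and `y · g` are both near `x`, then `g` is near `1`. -/
lemma isClosedEmbedding_act (hact : IsHolomorphicAction X G) (hfree : IsFreeAction X G)
    (hproper : IsProperAction X G) :
    IsClosedEmbedding (fun q : X × G => (q.1, q.1 <• q.2)) := by
  refine IsClosedEmbedding.of_continuous_injective_isClosedMap
    (continuous_fst.prodMk hact.continuous) ?_ hproper.isClosedMap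
  rintro ⟨x, g⟩ ⟨y, h⟩ hxy
  obtain ⟨h1, h2⟩ := Prod.ext_iff.1 hxy
  dsimp only at h1 h2
  subst h1
  refine Prod.ext rfl (mul_inv_eq_one.1 (hfree x (g * h⁻¹) ?_))
  rw [right_act_mul, h2, ← right_act_mul, mul_inv_cancel, right_act_one]

variable [LieGroup G.I ω G]

lemma finrank_le_of_isFreeAction (hact : IsHolomorphicAction X G) (hfree : IsFreeAction X G)
    (x : X) : Module.finrank ℂ G.Model ≤ Module.finrank ℂ X.Model := by
  obtain ⟨φ⟩ := G.nonempty_centredCoord 1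
  obtain ⟨ψ⟩ := X.nonempty_centredCoord x
  exact LinearMap.finrank_le_finrank_of_injective
    (f := (fderiv ℂ (fun b => ψ.coord (x <• φ.point b)) 0 : G.Model →ₗ[ℂ] X.Model))
    (fderiv_orbit_injective hact hfree φ ψ).2

/-- An injective linear map can be completed to an isomorphism from a product. -/
lemma exists_prod_equiv_of_injective {V V' E : Type*} [NormedAddCommGroup V] [NormedSpace ℂ V]
    [FiniteDimensional ℂ V] [NormedAddCommGroup V'] [NormedSpace ℂ V'] [FiniteDimensional ℂ V']
    [NormedAddCommGroup E] [NormedSpace ℂ E] [FiniteDimensional ℂ E]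
    (hE : Module.finrank ℂ E + Module.finrank ℂ V = Module.finrank ℂ V') (L : V →L[ℂ] V')
    (hL : Function.Injective L) :
    ∃ (ι : E →L[ℂ] V') (D : (E × V) ≃L[ℂ] V'), ∀ q, D q = ι q.1 + L q.2 := by
  obtain ⟨K, hK⟩ := Submodule.exists_isCompl (LinearMap.range (L : V →ₗ[ℂ] V'))
  have h1 : Module.finrank ℂ (LinearMap.range (L : V →ₗ[ℂ] V')) = Module.finrank ℂ V :=
    LinearMap.finrank_range_of_inj hL
  have h2 := Submodule.finrank_add_eq_of_isCompl hK
  have e : E ≃ₗ[ℂ] K := LinearEquiv.ofFinrankEq E K (by omega)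
  let ι : E →ₗ[ℂ] V' := K.subtype.comp e.toLinearMap
  let D : (E × V) →ₗ[ℂ] V' := ι.coprod (L : V →ₗ[ℂ] V')
  have hD : Function.Injective D := by
    rw [injective_iff_map_eq_zero]
    rintro ⟨w, v⟩ h
    have h3 : (e w : V') + L v = 0 := h
    have h4 : (e w : V') = 0 := by
      refine (Submodule.disjoint_def.1 hK.disjoint) _ ?_ (e w).2
      rw [eq_neg_of_add_eq_zero_left h3]
      exact Submodule.neg_mem _ ⟨v, rfl⟩
    have h5 : L v = 0 := by rwa [h4, zero_add] at h3
    have h6 : w = 0 := e.injective ((Subtype.ext h4).trans (map_zero e).symm)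
    exact Prod.ext h6 (hL (h5.trans (map_zero L).symm))
  refine ⟨LinearMap.toContinuousLinearMap ι, (LinearEquiv.ofInjectiveOfFinrankEq D hD
    (by rw [Module.finrank_prod, hE])).toContinuousLinearEquiv, fun q => rfl⟩

/-- Near a point of a free orbit there are holomorphic coordinates `(α, β)` with values in
`E × G`, inverse to `(w, g) ↦ sec w · g`. -/
theorem exists_slice_coordinates {E : Type} [NormedAddCommGroup E] [NormedSpace ℂ E]
    [FiniteDimensional ℂ E]
    (hE : Module.finrank ℂ E + Module.finrank ℂ G.Model = Module.finrank ℂ X.Model)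
    (hact : IsHolomorphicAction X G) (hfree : IsFreeAction X G) (x : X) :
    ∃ (sec : E → X) (α : X → E) (β : X → G), sec 0 = x ∧
      (∀ᶠ w in 𝓝 0, ContMDiffAt 𝓘(ℂ, E) X.I ω sec w) ∧
      (∀ᶠ y in 𝓝 x, ContMDiffAt X.I 𝓘(ℂ, E) ω α y ∧ ContMDiffAt X.I G.I ω β y ∧
        sec (α y) <• β y = y) ∧
      (∀ᶠ q in 𝓝 ((0 : E), (1 : G)), α (sec q.1 <• q.2) = q.1 ∧ β (sec q.1 <• q.2) = q.2) := by
  obtain ⟨φ⟩ := G.nonempty_centredCoord 1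
  obtain ⟨ψ⟩ := X.nonempty_centredCoord x
  obtain ⟨hd, hinj⟩ := fderiv_orbit_injective hact hfree φ ψ
  obtain ⟨ι, D, hD⟩ := exists_prod_equiv_of_injective hE _ hinj
  let sec : E → X := fun w => ψ.point (ι w)
  have sec0 : sec 0 = x := by simp only [sec, map_zero, ψ.point_zero]
  have hsec : ContMDiffAt 𝓘(ℂ, E) X.I ω sec 0 := by
    refine ContMDiffAt.comp (g := ψ.point) 0 ?_ ι.contDiff.contMDiff.contMDiffAt
    rw [map_zero]
    exact ψ.contMDiffAt_point
  let Φ : E × G.Model → X.Model := fun q => ψ.coord (sec q.1 <• φ.point q.2)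
  have hact0 : sec 0 <• φ.point 0 = x := by rw [sec0, φ.point_zero, right_act_one]
  have hΦ : ContDiffAt ℂ ω Φ (0, 0) := by
    rw [← contMDiffAt_iff_contDiffAt]
    refine ContMDiffAt.comp (g := ψ.coord) (0, 0) ?_ (ContMDiffAt.act hact
      (ContMDiffAt.comp (g := sec) (0, 0) hsec contDiff_fst.contMDiff.contMDiffAt)
      (ContMDiffAt.comp (g := φ.point) (0, 0) φ.contMDiffAt_point
        contDiff_snd.contMDiff.contMDiffAt))
    simp only [hact0]
    exact ψ.contMDiffAt_coord
  have hΦ0 : Φ (0, 0) = 0 := by simp only [Φ, hact0, ψ.coord_self]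
  -- The partial derivatives are `ι` along the slice and the derivative of the orbit map along the
  -- group; `ι` was chosen to make their sum invertible.
  have hΦd : HasFDerivAt Φ (D : (E × G.Model) →L[ℂ] X.Model) (0, 0) := by
    have h0 : HasFDerivAt Φ (fderiv ℂ Φ (0, 0)) (0, 0) :=
      (hΦ.differentiableAt (by simp)).hasFDerivAt
    have h1 : HasFDerivAt (fun w : E => Φ (w, 0)) ι 0 := by
      refine ι.hasFDerivAt.congr_of_eventuallyEq ?_
      have hc : Tendsto ι (𝓝 0) (𝓝 0) := by simpa using ι.continuous.tendsto 0
      filter_upwards [hc.eventually ψ.coord_point] with w hw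
      simp only [Φ, sec, φ.point_zero, right_act_one, hw]
    have h1' : HasFDerivAt (fun w : E => Φ (w, 0)) _ 0 :=
      HasFDerivAt.comp (g := Φ) (0 : E) h0 ((hasFDerivAt_id (0 : E)).prodMk
        (hasFDerivAt_const (0 : G.Model) (0 : E)))
    have h2 : HasFDerivAt (fun b : G.Model => Φ (0, b))
        (fderiv ℂ (fun b => ψ.coord (x <• φ.point b)) 0) 0 := by
      simp only [Φ, sec0]
      exact hd.hasFDerivAt
    have h2' : HasFDerivAt (fun b : G.Model => Φ (0, b)) _ 0 :=
      HasFDerivAt.comp (g := Φ) (0 : G.Model) h0 ((hasFDerivAt_const (0 : E) (0 : G.Model)).prodMk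
        (hasFDerivAt_id (0 : G.Model)))
    convert h0 using 1
    refine ContinuousLinearMap.ext fun q => ?_
    have e1 := congrArg (fun L : E →L[ℂ] X.Model => L q.1) (h1'.unique h1)
    have e2 := congrArg (fun L : G.Model →L[ℂ] X.Model => L q.2) (h2'.unique h2)
    simp only [ContinuousLinearMap.comp_apply, ContinuousLinearMap.prod_apply,
      ContinuousLinearMap.id_apply, zero_apply] at e1 e2
    rw [ContinuousLinearEquiv.coe_coe, hD, ← e1, ← e2, ← map_add]
    simp
  let l := hΦ.toOpenPartialHomeomorph Φ hΦd (by simp)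
  have hl0 : (0, 0) ∈ l.source := hΦ.mem_toOpenPartialHomeomorph_source hΦd (by simp)
  have hl0' : (0 : X.Model) ∈ l.target := by
    have := l.map_source hl0
    rwa [show l (0, 0) = 0 from hΦ0] at this
  have hls0 : l.symm 0 = (0, 0) := by
    have := l.left_inv hl0
    rwa [show l (0, 0) = 0 from hΦ0] at this
  have hls : ContDiffAt ℂ ω l.symm 0 := by
    have := hΦ.to_localInverse hΦd (by simp)
    rwa [hΦ0] at this
  let θ : X → E × G.Model := fun y => l.symm (ψ.coord y)
  have hθx : θ x = (0, 0) := by simp only [θ, ψ.coord_self, hls0]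
  have hθ : ContMDiffAt X.I 𝓘(ℂ, E × G.Model) ω θ x := by
    refine ContMDiffAt.comp (g := l.symm) x ?_ ψ.contMDiffAt_coord
    rw [ψ.coord_self]
    exact hls.contMDiffAt
  have hα : ContMDiffAt X.I 𝓘(ℂ, E) ω (fun y => (θ y).1) x :=
    ContMDiffAt.comp (g := Prod.fst) x contDiff_fst.contMDiff.contMDiffAt hθ
  have hβ : ContMDiffAt X.I G.I ω (fun y => φ.point (θ y).2) x := by
    refine ContMDiffAt.comp (g := φ.point) x ?_
      (ContMDiffAt.comp (g := Prod.snd) x contDiff_snd.contMDiff.contMDiffAt hθ)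
    rw [hθx]
    exact φ.contMDiffAt_point
  have hcoord : Tendsto ψ.coord (𝓝 x) (𝓝 0) := by
    simpa only [ψ.coord_self] using ψ.contMDiffAt_coord.continuousAt.tendsto
  have hθc : Tendsto θ (𝓝 x) (𝓝 (0, 0)) := by
    simpa only [hθx] using hθ.continuousAt.tendsto
  have hP : Tendsto (fun q : E × G.Model => sec q.1 <• φ.point q.2) (𝓝 (0, 0)) (𝓝 x) := by
    have : ContMDiffAt 𝓘(ℂ, E × G.Model) X.I ω
        (fun q : E × G.Model => sec q.1 <• φ.point q.2) (0, 0) := ContMDiffAt.act hact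
      (ContMDiffAt.comp (g := sec) (0, 0) hsec contDiff_fst.contMDiff.contMDiffAt)
      (ContMDiffAt.comp (g := φ.point) (0, 0) φ.contMDiffAt_point
        contDiff_snd.contMDiff.contMDiffAt)
    simpa only [hact0] using this.continuousAt.tendsto
  refine ⟨sec, fun y => (θ y).1, fun y => φ.point (θ y).2, sec0, (contMDiffAt_iff_contMDiffAt_nhds (by simp)).1 hsec, ?_, ?_⟩
  · filter_upwards [(contMDiffAt_iff_contMDiffAt_nhds (by simp)).1 hα,
      (contMDiffAt_iff_contMDiffAt_nhds (by simp)).1 hβ,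
      hcoord.eventually (l.open_target.mem_nhds hl0'), ψ.point_coord,
      (hP.comp hθc).eventually ψ.point_coord] with y h1 h2 h3 h4 h5
    refine ⟨h1, h2, ?_⟩
    have h6 : ψ.coord (sec (θ y).1 <• φ.point (θ y).2) = ψ.coord y := l.right_inv h3
    simp only [Function.comp_apply] at h5
    rw [← h5, h6, h4]
  · have hc : Tendsto (fun q : E × G => (q.1, φ.coord q.2)) (𝓝 (0, 1)) (𝓝 (0, 0)) := by
      rw [nhds_prod_eq, nhds_prod_eq]
      refine Tendsto.prodMap tendsto_id ?_
      simpa only [φ.coord_self] using φ.contMDiffAt_coord.continuousAt.tendsto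
    have hc2 : Tendsto (fun q : E × G => q.2) (𝓝 (0, 1)) (𝓝 1) := continuous_snd.tendsto _
    filter_upwards [hc.eventually (l.open_source.mem_nhds hl0), hc2.eventually φ.point_coord]
      with q h1 h2
    have h3 : θ (sec q.1 <• q.2) = (q.1, φ.coord q.2) := by
      have := l.left_inv h1
      rw [← this]
      change l.symm (ψ.coord (sec q.1 <• q.2)) =
        l.symm (ψ.coord (sec q.1 <• φ.point (φ.coord q.2)))
      rw [h2]
    simp only [h3, h2, and_self]

/-- A free and proper action has slices. -/
theorem exists_localSlice {E : Type} [NormedAddCommGroup E] [NormedSpace ℂ E]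
    [FiniteDimensional ℂ E]
    (hE : Module.finrank ℂ E + Module.finrank ℂ G.Model = Module.finrank ℂ X.Model)
    (hact : IsHolomorphicAction X G) (hfree : IsFreeAction X G) (hproper : IsProperAction X G)
    (x : X) : ∃ s : LocalSlice X G E, x ∈ s.O := by
  obtain ⟨sec, α, β, sec0, hsec, hgood, hinv⟩ := exists_slice_coordinates hE hact hfree x
  have hsecc : Tendsto sec (𝓝 0) (𝓝 x) := sec0 ▸ hsec.self_of_nhds.continuousAt.tendsto
  obtain ⟨A, hA, B, hB, hAB⟩ := mem_nhds_prod_iff.1 hinv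
  have hV : ∃ V ∈ 𝓝 (x, x), (fun q : X × G => (q.1, q.1 <• q.2)) ⁻¹' V ⊆ Set.univ ×ˢ B := by
    have h1 := (isClosedEmbedding_act hact hfree hproper).isInducing.nhds_eq_comap (x, (1 : G))
    have h2 : Set.univ ×ˢ B ∈ 𝓝 (x, (1 : G)) := prod_mem_nhds univ_mem hB
    rw [h1] at h2
    simpa only [right_act_one] using mem_comap.1 h2
  obtain ⟨V, hV, hVB⟩ := hV
  obtain ⟨V₁, hV₁, V₂, hV₂, hV12⟩ := mem_nhds_prod_iff.1 hV
  have hev : ∀ᶠ w in 𝓝 0, w ∈ A ∧ sec w ∈ V₁ ∧ sec w ∈ V₂ ∧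
      ContMDiffAt 𝓘(ℂ, E) X.I ω sec w ∧ ∀ᶠ y in 𝓝 (sec w), ContMDiffAt X.I 𝓘(ℂ, E) ω α y ∧
        ContMDiffAt X.I G.I ω β y ∧ sec (α y) <• β y = y := by
    filter_upwards [hA, hsecc.eventually hV₁, hsecc.eventually hV₂, hsec,
      hsecc.eventually hgood.eventually_nhds] with w h1 h2 h3 h4 h5 using ⟨h1, h2, h3, h4, h5⟩
  obtain ⟨W, hW, hWo, hW0⟩ := mem_nhds_iff.1 hev
  have hαβ : ∀ w ∈ W, α (sec w) = w ∧ β (sec w) = 1 := fun w hw => by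
    have : (w, (1 : G)) ∈ A ×ˢ B := ⟨(hW hw).1, mem_of_mem_nhds hB⟩
    simpa only [Set.mem_ofPred_eq, right_act_one] using hAB this
  -- Both ends are near `x`, so properness, through `V`, forces `g ∈ B`. There the local coordinates
  -- `α` and `β` determine `w` and `g`.
  have huniq1 : ∀ w ∈ W, ∀ w' ∈ W, ∀ g : G, sec w <• g = sec w' → w = w' ∧ g = 1 := by
    intro w hw w' hw' g hg
    have h1 : (sec w, g) ∈ (fun q : X × G => (q.1, q.1 <• q.2)) ⁻¹' V :=
      hV12 ⟨(hW hw).2.1, by dsimp only; rw [hg]; exact (hW hw').2.2.1⟩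
    have h2 : (w, g) ∈ A ×ˢ B := ⟨(hW hw).1, (hVB h1).2⟩
    obtain ⟨h3, h4⟩ := hAB h2
    dsimp only at h3 h4
    rw [hg] at h3 h4
    exact ⟨h3.symm.trans (hαβ w' hw').1, h4.symm.trans (hαβ w' hw').2⟩
  have huniq : ∀ w ∈ W, ∀ w' ∈ W, ∀ g g' : G, sec w <• g = sec w' <• g' → w = w' ∧ g = g' := by
    intro w hw w' hw' g g' hg
    obtain ⟨h1, h2⟩ := huniq1 w hw w' hw' (g * g'⁻¹) <| by
      rw [right_act_mul, hg, ← right_act_mul, mul_inv_cancel, right_act_one]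
    exact ⟨h1, mul_inv_eq_one.1 h2⟩
  let O : Set X := {y | ∃ w ∈ W, ∃ g : G, sec w <• g = y}
  have hch : ∀ y, ∃ w : E, ∃ g : G, y ∈ O → w ∈ W ∧ sec w <• g = y := fun y => by
    by_cases hy : y ∈ O
    · obtain ⟨w, hw, g, hg⟩ := hy
      exact ⟨w, g, fun _ => ⟨hw, hg⟩⟩
    · exact ⟨0, 1, fun h => (hy h).elim⟩
  choose slice coord hch using hch
  have hval : ∀ w ∈ W, ∀ g : G, slice (sec w <• g) = w ∧ coord (sec w <• g) = g :=
    fun w hw g => by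
      obtain ⟨h1, h2⟩ := hch (sec w <• g) ⟨w, hw, g, rfl⟩
      exact huniq _ h1 w hw _ _ h2
  -- Translation by `g⁻¹` moves the situation back to the slice, where `α` and `β` are holomorphic.
  -- This yields both openness of `O` and holomorphy of `slice` and `coord`.
  have hloc : ∀ w ∈ W, ∀ g : G, ∀ᶠ y in 𝓝 (sec w <• g), y ∈ O ∧
      slice y = α (y <• g⁻¹) ∧ coord y = β (y <• g⁻¹) * g := fun w hw g => by
    have hback : (sec w <• g) <• g⁻¹ = sec w := by
      rw [← right_act_mul, mul_inv_cancel, right_act_one]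
    have hc : Tendsto (fun y => y <• g⁻¹) (𝓝 (sec w <• g)) (𝓝 (sec w)) := by
      have := (hact.contMDiff_act g⁻¹).continuous.tendsto (sec w <• g)
      simpa only [hback] using this
    have hg := (hW hw).2.2.2.2
    have hαc : Tendsto α (𝓝 (sec w)) (𝓝 w) := by
      simpa only [(hαβ w hw).1] using hg.self_of_nhds.1.continuousAt.tendsto
    filter_upwards [hc.eventually hg, (hαc.comp hc).eventually (hWo.mem_nhds hw)]
      with y ⟨_, _, h3⟩ h4
    have h5 : sec (α (y <• g⁻¹)) <• (β (y <• g⁻¹) * g) = y := by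
      rw [right_act_mul, h3, ← right_act_mul, inv_mul_cancel, right_act_one]
    have h6 := hval _ h4 (β (y <• g⁻¹) * g)
    simp only [Function.comp_apply] at h6
    rw [h5] at h6
    exact ⟨⟨_, h4, _, h5⟩, h6⟩
  have hsm : ∀ w ∈ W, ∀ g : G, ContMDiffAt X.I 𝓘(ℂ, E) ω slice (sec w <• g) ∧
      ContMDiffAt X.I G.I ω coord (sec w <• g) := fun w hw g => by
    have hback : (sec w <• g) <• g⁻¹ = sec w := by
      rw [← right_act_mul, mul_inv_cancel, right_act_one]
    obtain ⟨h1, h2, -⟩ := (hW hw).2.2.2.2.self_of_nhds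
    rw [← hback] at h1 h2
    have h3 := hact.contMDiff_act g⁻¹ (sec w <• g)
    refine ⟨(ContMDiffAt.comp (g := α) _ h1 h3).congr_of_eventuallyEq ?_,
      ((ContMDiffAt.comp (g := β) _ h2 h3).mul
        (contMDiffAt_const (c := g))).congr_of_eventuallyEq ?_⟩
    · filter_upwards [hloc w hw g] with y hy using hy.2.1
    · filter_upwards [hloc w hw g] with y hy using hy.2.2
  refine ⟨⟨W, hWo, O, ?_, sec, slice, coord, ?_, ?_, ?_, ?_, ?_, ?_, ?_, ?_, ?_, ?_, ?_⟩,
    ⟨0, hW0, 1, by rw [sec0, right_act_one]⟩⟩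
  · rw [isOpen_iff_mem_nhds]
    rintro _ ⟨w, hw, g, rfl⟩
    filter_upwards [hloc w hw g] with y hy using hy.1
  · exact fun w hw => (hW hw).2.2.2.1.contMDiffWithinAt
  · rintro _ ⟨w, hw, g, rfl⟩
    exact (hsm w hw g).1.contMDiffWithinAt
  · rintro _ ⟨w, hw, g, rfl⟩
    exact (hsm w hw g).2.contMDiffWithinAt
  · exact fun w hw => ⟨w, hw, 1, right_act_one _⟩
  · exact fun y hy => (hch y hy).1
  · rintro _ h ⟨w, hw, g, rfl⟩
    exact ⟨w, hw, g * h, right_act_mul _ _ _⟩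
  · rintro _ h ⟨w, hw, g, rfl⟩
    rw [← right_act_mul, (hval w hw _).1, (hval w hw _).1]
  · rintro _ h ⟨w, hw, g, rfl⟩
    rw [← right_act_mul, (hval w hw _).2, (hval w hw _).2]
  · intro w hw
    have := (hval w hw 1).1
    rwa [right_act_one] at this
  · intro w hw
    have := (hval w hw 1).2
    rwa [right_act_one] at this
  · exact fun y hy => (hch y hy).2

end Slices

/-! ### Conclusion -/

/-- The orbit space of a free and proper action is a complex analytic manifold, and the action makes
`X` a principal bundle over it. -/
theorem exists_isPrincipalBundle_orbitProj {G X : AnMfd.{u}} [Group G] [LieGroup G.I ω G]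
    [MulAction Gᵐᵒᵖ X] (hact : IsHolomorphicAction X G) (hfree : IsFreeAction X G)
    (hproper : IsProperAction X G) :
    ∃ (E : Type) (_ : NormedAddCommGroup E) (_ : NormedSpace ℂ E) (_ : FiniteDimensional ℂ E)
      (_ : T2Space (OrbitSpace X G)) (_ : ChartedSpace E (OrbitSpace X G))
      (_ : IsManifold 𝓘(ℂ, E) ω (OrbitSpace X G)),
      IsPrincipalBundle G (P := X) (S := AnMfd.of E (OrbitSpace X G)) (orbitProj X G) := by
  have := t2Space_orbitSpace hact hproper
  -- If `X` is empty the subtraction may truncate, but then no slice is needed; any point of `X`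
  -- gives the inequality of dimensions.
  let d := Module.finrank ℂ X.Model - Module.finrank ℂ G.Model
  have hs : ∀ x : X, ∃ s : LocalSlice X G (Fin d → ℂ), x ∈ s.O := fun x =>
    exists_localSlice (by
      rw [Module.finrank_fin_fun]
      exact Nat.sub_add_cancel (finrank_le_of_isFreeAction hact hfree x)) hact hfree hproper x
  obtain ⟨cs, man, h⟩ := exists_isPrincipalBundle_of_localSlice hact hs
  exact ⟨Fin d → ℂ, _, _, inferInstance, this, cs, man, h⟩

theorem mainTheorem11 (G X : AnMfd.{u}) [Group G] [LieGroup G.I ω G]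
    [MulAction Gᵐᵒᵖ X] (hact : IsHolomorphicAction X G) :
    ((∃ M : AnMfd.{u}, IsFineModuliSpace (quotientStack X G) M) ↔
      IsFreeAction X G ∧ IsProperAction X G) ∧
    (IsFreeAction X G ∧ IsProperAction X G →
      ∃ (E : Type) (_ : NormedAddCommGroup E) (_ : NormedSpace ℂ E) (_ : FiniteDimensional ℂ E)
        (_ : T2Space (OrbitSpace X G)) (_ : ChartedSpace E (OrbitSpace X G))
        (_ : IsManifold 𝓘(ℂ, E) ω (OrbitSpace X G)),
        IsFineModuliSpace (quotientStack X G) (AnMfd.of E (OrbitSpace X G)) ∧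
        ∃ (h : IsPrincipalBundle G (P := X) (S := AnMfd.of E (OrbitSpace X G)) (orbitProj X G))
          (e : Bicategory.Equivalence (quotientStack X G) (AnMfd.of E (OrbitSpace X G)).stack)
          (φ : e.inv.obj (Over.mk (𝟙 (AnMfd.of E (OrbitSpace X G)))) ≅
            OrbitFamily.ofTotalX X G h),
          (quotientStack X G).p.IsHomLift (𝟙 (AnMfd.of E (OrbitSpace X G))) φ.hom) := by
  refine ⟨⟨fun ⟨M, ⟨e⟩⟩ =>
    OrbitFamily.free_and_proper_of_isTerminal hact (isTerminalInvObjId e), fun ⟨h1, h2⟩ => ?_⟩,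
    fun ⟨h1, h2⟩ => ?_⟩
  · obtain ⟨E, _, _, _, _, _, _, h⟩ := exists_isPrincipalBundle_orbitProj hact h1 h2
    exact ⟨_, ⟨OrbitFamily.stackEquivalence h⟩⟩
  · obtain ⟨E, i1, i2, i3, i4, i5, i6, h⟩ := exists_isPrincipalBundle_orbitProj hact h1 h2
    exact ⟨E, i1, i2, i3, i4, i5, i6, ⟨OrbitFamily.stackEquivalence h⟩, h,
      OrbitFamily.exists_stackEquivalence h⟩
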